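/- Let $d\ge 0$ and let $\mathbb C\langle x_1,\dots,x_d\rangle$ be the $*$-algebra of polynomials in non-commuting self-adjoint variables; for a word $\vec u=(u(1),\dots,u(n))$ write $x_{\vec u}=x_{u(1)}\cdots x_{u(n)}$, and $X_{\vec u}=X_{u(1)}\cdots X_{u(n)}$ for operators $X_1,\dots,X_d$. A state is a linear functional $\phi$ on it that is unital, $*$-compatible and satisfies $\phi[P^*P]\ge 0$. For a unital functional $\phi$ let $M^\phi(\mathbf w)=\sum_{|\vec u|\ge 1}\phi[x_{\vec u}]w_{\vec u}$ be its moment series in non-commuting variables, $\eta^\phi=1-(1+M^\phi)^{-1}$ its Boolean cumulant series, and $R^\phi$ its free cumulant series, i.e. the series without constant term determined by $M^\phi(\mathbf w)=R^\phi\bigl((1+M^\phi(\mathbf w))\mathbf w\bigr)$. Unital functionals $\phi\boxplus\psi$, $\phi^{\boxplus t}$, $\Phi[\rho,\psi]$, $\mathbb B[\phi]$ are defined by $$R^{\phi\boxplus\psi}=R^\phi+R^\psi,\qquad R^{\phi^{\boxplus t}}=tR^\phi,\qquad \eta^{\Phi[\rho,\psi]}(\mathbf w)=(1+M^\psi(\mathbf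 w))^{-1}R^\rho\bigl((1+M^\psi(\mathbf w))\mathbf w\bigr),\qquad R^{\mathbb B[\phi]}=\eta^\phi .$$ A state $\rho$ is freely infinitely divisible if $\rho^{\boxplus t}$ is a state for all $t\ge 0$. The Boolean Fock space of a Hilbert space $\mathcal H$ is $\mathbb C\Omega\oplus\mathcal H$, with $a^{b,+}_\zeta(\varepsilon)=\langle\Omega,\varepsilon\rangle\zeta$, $a^{b,-}_\zeta(\varepsilon)=\langle\zeta,\varepsilon\rangle\Omega$, and operators on $\mathcal H$ extended by $\Omega\mapsto 0$. The full Fock space is $\mathcal F(\mathcal H)=\mathbb C\Omega\oplus\bigoplus_{n\ge1}\mathcal H^{\otimes n}$, with $a^{f,+}_\zeta(\varepsilon_1\otimes\dots\otimes\varepsilon_n)=\zeta\otimes\varepsilon_1\otimes\dots\otimes\varepsilon_n$, $a^{f,-}_\zeta(\varepsilon_1\otimes\dots\otimes\varepsilon_n)=\langle\zeta,\varepsilon_1\rangle\varepsilon_2\otimes\dots\otimes\varepsilon_n$, $p(H)(\varepsilon_1\otimes\dots\otimes\varepsilon_n)=(H\varepsilon_1)\otimes\varepsilon_2\otimes\dots\otimes\varepsilon_n$,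 and $a^{f,-}_\zeta\Omega=p(H)\Omega=0$. $P_\Omega$, $P_\xi$ denote the projections onto $\Omega$, $\xi$. All tuples of operators below are symmetric operators with a common invariant dense domain containing the distinguished vectors; domains of operators on tensor products and Fock spaces are the algebraic ones built from the given domains. Consider the following data: for a state $\psi$, a Hilbert space $\mathcal K$, a unit vector $\xi\in\mathcal K$ and operators $K_i$ on $\mathcal K$ with $\psi[x_{\vec u}]=\langle\xi,K_{\vec u}\xi\rangle$; for a state $\phi$, a Hilbert space $\mathcal K$, $\varepsilon_i\in\mathcal K$, operators $S_i$ on $\mathcal K$ and $\alpha_i\in\mathbb R$ with $\phi[x_{\vec u}]=\langle\Omega,(a^{b,+}_{\varepsilon_i}+a^{b,-}_{\varepsilon_i}+S_i+\alpha_iP_\Omega)_{\vec u}\Omega\rangle$; for a freely infinitely divisible state $\rho$, a Hilbert space $\mathcal H$, $\zeta_i\in\mathcal H$, operators $H_i$ on $\mathcal H$ and $\lambda_i\in\mathbb R$ with $\rho[x_{\vec u}]=\langle\Omega,(a^{f,+}_{\zeta_i}+a^{f,-}_{\zeta_i}+p(H_i)+\lambda_iI)_{\vec u}\Omega\rangle$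 on $\mathcal F(\mathcal H)$. Such data exist for all such $\psi$, $\phi$, $\rho$, and for any choice of them the following hold. (a) For a freely infinitely divisible state $\rho$ and a state $\psi$, $\Phi[\rho,\psi]$ is a state, represented on the Boolean Fock space $\mathbb C\Omega\oplus(\mathcal K\otimes\mathcal H)$ by $$\Phi[\rho,\psi][x_{\vec u}]=\Bigl\langle\Omega,\bigl(a^{b,+}_{\xi\otimes\zeta_i}+a^{b,-}_{\xi\otimes\zeta_i}+K_i\otimes I+P_\xi\otimes H_i+\lambda_iP_\Omega\bigr)_{\vec u}\Omega\Bigr\rangle .$$ (b) For a state $\phi$, $\mathbb B[\phi]$ is a freely infinitely divisible state, represented on $\mathcal F(\mathcal K)$ by $$\mathbb B[\phi][x_{\vec u}]=\Bigl\langle\Omega,\bigl(a^{f,+}_{\varepsilon_i}+a^{f,-}_{\varepsilon_i}+p(S_i)+\alpha_iI\bigr)_{\vec u}\Omega\Bigr\rangle .$$ (c) For $\rho,\psi$ as in (a), $\psi\boxplus\rho$ is a state, represented on $\mathcal F(\mathcal K\otimes\mathcal H)\otimes\mathcal K\simeq\mathcal K\oplus\bigoplus_{n\ge1}(\mathcal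 K\otimes\mathcal H)^{\otimes n}\otimes\mathcal K$ by $$(\psi\boxplus\rho)[x_{\vec u}]=\Bigl\langle\Omega\otimes\xi,\bigl(a^{f,+}_{\xi\otimes\zeta_i}\otimes I+a^{f,-}_{\xi\otimes\zeta_i}\otimes I+P_\Omega\otimes K_i+p(K_i\otimes I)\otimes I+p(P_\xi\otimes H_i)\otimes I+\lambda_iI\bigr)_{\vec u}(\Omega\otimes\xi)\Bigr\rangle ,$$ where $P_\Omega\otimes K_i+p(K_i\otimes I)\otimes I$ is the action of $K_i$ on the leftmost factor $\mathcal K$ of every summand. (d) For $\rho,\psi$ as in (a), $\mathbb B[\Phi[\rho,\psi]]=\Phi[\rho,\psi\boxplus\rho]$, and both are represented on $\mathcal F(\mathcal K\otimes\mathcal H)$ by $$\Bigl\langle\Omega,\bigl(a^{f,+}_{\xi\otimes\zeta_i}+a^{f,-}_{\xi\otimes\zeta_i}+p(K_i\otimes I+P_\xi\otimes H_i)+\lambda_iI\bigr)_{\vec u}\Omega\Bigr\rangle .$$ -/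

import Mathlib

open scoped InnerProductSpace TensorProduct DirectSum ComplexConjugate

universe u v

noncomputable section

namespace TwoState

/-! ### Non-commutative polynomials, functionals and states -/

/-- The algebra `ℂ⟨x₁, …, x_d⟩` of polynomials in `d` non-commuting variables. -/
abbrev NCPoly (d : ℕ) : Type := MonoidAlgebra ℂ (FreeMonoid (Fin d))

/-- The monomial `x_{u(1)} x_{u(2)} ⋯ x_{u(n)}`. -/
def monomial {d : ℕ} (u : List (Fin d)) : NCPoly d :=
  MonoidAlgebra.single (FreeMonoid.ofList u) 1

/-- The involution of `ℂ⟨x₁, …, x_d⟩`: conjugate-linear, reversing words, fixing each `x_i`. -/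
def adj {d : ℕ} (P : NCPoly d) : NCPoly d :=
  P.coeff.sum fun u c => MonoidAlgebra.single (FreeMonoid.ofList u.toList.reverse) (conj c)

/-- Linear functionals on `ℂ⟨x₁, …, x_d⟩`. -/
abbrev Functional (d : ℕ) : Type := NCPoly d →ₗ[ℂ] ℂ

/-- States: unital, `*`-compatible and positive linear functionals. -/
structure IsState {d : ℕ} (φ : Functional d) : Prop where
  map_one : φ 1 = 1
  map_adj : ∀ P, φ (adj P) = conj (φ P)
  nonneg : ∀ P, 0 ≤ (φ (adj P * P)).re

/-! ### Non-commutative formal power series -/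

/-- Formal power series in `d` non-commuting variables, given by their coefficients. -/
abbrev NCSeries (d : ℕ) : Type := List (Fin d) → ℂ

namespace NCSeries

variable {d : ℕ}

/-- The series `1`. -/
def one : NCSeries d := fun u => if u = [] then 1 else 0

/-- The product of two series. -/
def mul (f g : NCSeries d) : NCSeries d := fun u =>
  ∑ k ∈ Finset.range (u.length + 1), f (u.take k) * g (u.drop k)

/-- The inverse of a series `f` with constant term `1`, determined by `f * inv f = 1`. -/
def inv (f : NCSeries d) : NCSeries d
  | [] => 1
  | i :: u => -∑ k ∈ Finset.range (u.length + 1), f (i :: u.take k) * inv f (u.drop k)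
termination_by u => u.length
decreasing_by simp

/-- The left partial derivative `D_i`. -/
def D (i : Fin d) (f : NCSeries d) : NCSeries d := fun u => f (i :: u)

/-- The substitution `f(A z) = f(A z₁, …, A z_d)`, for which
`f(A z) = f(0) + ∑ i, A z_i (D_i f)(A z)`. -/
def subst (A : NCSeries d) (f : NCSeries d) (u : List (Fin d)) : ℂ :=
  (if u = [] then f [] else 0) +
    ∑ k : Fin u.length, A (u.take k) * subst A (D (u.get k) f) (u.drop (k + 1))
termination_by u.length
decreasing_by
  have := k.isLt
  simp only [List.length_drop]; omega

theorem mul_inv (f : NCSeries d) (hf : f [] = 1) : mul f (inv f) = one := by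
  funext u
  cases u with
  | nil => simp [mul, inv, one, hf]
  | cons i u =>
    simp [mul, one, Finset.sum_range_succ' _ (u.length + 1), hf]
    rw [inv]; ring

/-- An equation `f u = F f u` whose right side only involves the values of `f` on words shorter
than `u` has a unique solution. -/
theorem existsUnique_fix (F : NCSeries d → NCSeries d)
    (hF : ∀ f g u, (∀ v, v.length < u.length → f v = g v) → F f u = F g u) :
    ∃! f : NCSeries d, ∀ u, f u = F f u := by
  have step : ∀ n (u : List (Fin d)), u.length < n → F^[n + 1] 0 u = F^[n] 0 u := by
    intro n
    induction n with
    | zero => intro u hu; omega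
    | succ n ih =>
      intro u hu
      have h := hF (F^[n + 1] 0) (F^[n] 0) u fun v hv => ih v (by omega)
      rwa [← Function.iterate_succ_apply' F, ← Function.iterate_succ_apply' F] at h
  have stable : ∀ n (u : List (Fin d)), u.length < n → F^[n] 0 u = F^[u.length + 1] 0 u := by
    intro n u hu
    obtain ⟨k, rfl⟩ := Nat.exists_eq_add_of_lt hu
    induction k with
    | zero => rfl
    | succ k ih =>
      rw [← ih (by omega)]
      exact step (u.length + k + 1) u (by omega)
  refine ⟨fun u => F^[u.length + 1] 0 u, fun u => ?_, fun g hg => ?_⟩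
  · change F^[u.length + 1] 0 u = _
    rw [Function.iterate_succ_apply']
    exact hF _ _ _ fun v hv => stable _ v hv
  · have hn : ∀ n (u : List (Fin d)), u.length < n → g u = F^[n] 0 u := by
      intro n
      induction n with
      | zero => intro u hu; omega
      | succ n ih =>
        intro u hu
        rw [hg, Function.iterate_succ_apply']
        exact hF _ _ _ fun v hv => ih v (by omega)
    funext u
    exact hn _ u (by omega)

theorem subst_congr {A B f g : NCSeries d} (u : List (Fin d))
    (hA : ∀ v, v.length < u.length → A v = B v) (hf : ∀ v, v.length ≤ u.length → f v = g v) :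
    subst A f u = subst B g u := by
  rw [subst, subst]
  have h0 : f [] = g [] := hf [] (by simp)
  rw [h0]
  congr 1
  refine Finset.sum_congr rfl fun k _ => ?_
  have hk := k.isLt
  rw [hA _ (by simp), subst_congr (u.drop (k + 1))]
  · intro v hv
    exact hA v (by simp at hv; omega)
  · intro v hv
    exact hf _ (by simp at hv ⊢; omega)
termination_by u.length
decreasing_by
  have := k.isLt
  simp only [List.length_drop]; omega

/-- The coefficient of `f(A z)` at `u` is `f u` plus terms with values of `f` on shorter words. -/
theorem subst_sub_congr {A f g : NCSeries d} (hA : A [] = 1) (u : List (Fin d))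
    (hf : ∀ v, v.length < u.length → f v = g v) :
    subst A f u - f u = subst A g u - g u := by
  induction u generalizing f g with
  | nil => rw [subst, subst]; simp
  | cons i u ih =>
    rw [subst, subst]
    have h1 : subst A (D i f) u - f (i :: u) = subst A (D i g) u - g (i :: u) :=
      ih fun v hv => hf _ (by simpa using hv)
    have h2 : ∀ k : Fin u.length,
        subst A (D (u.get k) f) (u.drop (k + 1)) = subst A (D (u.get k) g) (u.drop (k + 1)) := by
      intro k
      have hk := k.isLt
      exact subst_congr _ (fun _ _ => rfl) fun v hv => hf _ (by simp at hv ⊢; omega)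
    simp only [List.length_cons, Fin.sum_univ_succ]
    simp only [List.get_eq_getElem] at h2
    simp [hA, h2]
    linear_combination h1

/-- Existence and uniqueness of the series `R` with `R(0) = 0` and `M(w) = R((1 + M(w)) w)`. -/
theorem existsUnique_cumulants (M : NCSeries d) (hM : M [] = 0) :
    ∃! R : NCSeries d, R [] = 0 ∧ ∀ u, u ≠ [] → M u = subst (one + M) R u := by
  have h1 : (one + M : NCSeries d) [] = 1 := by simp [one, hM]
  obtain ⟨R, hR, huniq⟩ := existsUnique_fix
    (fun (R : NCSeries d) u => if u = [] then 0 else M u - (subst (one + M) R u - R u))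
    (fun f g u h => by rw [subst_sub_congr h1 u h])
  refine ⟨R, ⟨by simpa using hR [], fun u hu => ?_⟩, fun S hS => huniq S fun u => ?_⟩
  · have := hR u
    simp only [hu, if_false] at this
    linear_combination -this
  · by_cases hu : u = []
    · simp [hu, hS.1]
    · simp only [hu, if_false]
      linear_combination -(hS.2 u hu)

/-- Existence and uniqueness of the series `M` with `M(0) = 0` and `M(w) = R((1 + M(w)) w)`. -/
theorem existsUnique_moments (R : NCSeries d) :
    ∃! M : NCSeries d, M [] = 0 ∧ ∀ u, u ≠ [] → M u = subst (one + M) R u := by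
  obtain ⟨M, hM, huniq⟩ := existsUnique_fix
    (fun (M : NCSeries d) u => if u = [] then 0 else subst (one + M) R u)
    (fun f g u h => by
      simp only [subst_congr (A := one + f) (B := one + g) u
        (fun v hv => by simp [h v hv]) (fun _ _ => rfl)])
  refine ⟨M, ⟨by simpa using hM [], fun u hu => by simpa [hu] using hM u⟩,
    fun S hS => huniq S fun u => ?_⟩
  by_cases hu : u = []
  · simp [hu, hS.1]
  · simpa [hu] using hS.2 u hu

end NCSeries

/-! ### Moments, cumulants, convolutions and the maps `Φ` and `𝔹` -/

variable {d : ℕ}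

open NCSeries

/-- The moment `φ[x_u]`. -/
def moment (φ : Functional d) (u : List (Fin d)) : ℂ := φ (monomial u)

/-- The moment generating function `M^φ`, without constant term. -/
def momentSeries (φ : Functional d) : NCSeries d := fun u => if u = [] then 0 else moment φ u

theorem momentSeries_nil (φ : Functional d) : momentSeries φ [] = 0 := by simp [momentSeries]

/-- The linear functional with `x_u ↦ m u`. -/
def ofMoments (m : NCSeries d) : Functional d :=
  Finsupp.linearCombination ℂ (fun u : FreeMonoid (Fin d) => m u.toList) ∘ₗ
    (MonoidAlgebra.coeffLinearEquiv ℂ).toLinearMap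

theorem moment_ofMoments (m : NCSeries d) (u : List (Fin d)) : moment (ofMoments m) u = m u := by
  simp [moment, ofMoments, monomial]

/-- The Boolean cumulant generating function `η^φ = 1 - (1 + M^φ)⁻¹`. -/
def booleanCumulants (φ : Functional d) : NCSeries d := one - inv (one + momentSeries φ)

/-- The unital functional with given Boolean cumulant generating function `η` (where `η(0) = 0`),
that is `1 + M = (1 - η)⁻¹`. -/
def ofBooleanCumulants (η : NCSeries d) : Functional d := ofMoments (inv (one - η))

/-- The free cumulant generating function `R^φ`, determined by `R(0) = 0` and
`M^φ(w) = R^φ((1 + M^φ(w)) w)`. -/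
def freeCumulants (φ : Functional d) : NCSeries d :=
  (existsUnique_cumulants (momentSeries φ) (momentSeries_nil φ)).choose

/-- The unital functional with given free cumulant generating function `R` (where `R(0) = 0`),
that is `M(w) = R((1 + M(w)) w)`. -/
def ofFreeCumulants (R : NCSeries d) : Functional d :=
  ofMoments (one + (existsUnique_moments R).choose)

/-- The free convolution `φ ⊞ ψ`. -/
def freeConv (φ ψ : Functional d) : Functional d :=
  ofFreeCumulants (freeCumulants φ + freeCumulants ψ)

/-- The free convolution power `φ^{⊞ t}`. -/
def freePow (φ : Functional d) (t : ℝ) : Functional d :=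
  ofFreeCumulants ((t : ℂ) • freeCumulants φ)

/-- Freely infinitely divisible states: all `ρ^{⊞ t}`, `t ≥ 0`, are states. -/
structure IsFreelyInfDivState (ρ : Functional d) : Prop where
  isState : IsState ρ
  isState_freePow : ∀ t : ℝ, 0 ≤ t → IsState (freePow ρ t)

/-- The functional `Φ[ρ, ψ]`, with
`η^{Φ[ρ, ψ]}(w) = (1 + M^ψ(w))⁻¹ R^ρ((1 + M^ψ(w)) w)`. -/
def Phi (ρ ψ : Functional d) : Functional d :=
  ofBooleanCumulants
    (mul (inv (one + momentSeries ψ)) (subst (one + momentSeries ψ) (freeCumulants ρ)))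

/-- The Boolean-to-free Bercovici-Pata bijection `𝔹`, with `R^{𝔹[φ]} = η^φ`. -/
def BercoviciPata (φ : Functional d) : Functional d := ofFreeCumulants (booleanCumulants φ)


/-! ### Operators and representations -/

section Operators

variable {E F 𝓗 : Type*} [NormedAddCommGroup E] [InnerProductSpace ℂ E]
  [NormedAddCommGroup F] [InnerProductSpace ℂ F] [NormedAddCommGroup 𝓗] [InnerProductSpace ℂ 𝓗]

/-- The rank one operator `x ↦ ⟨w, x⟩ v`. -/
def ketBra (v w : E) : Module.End ℂ E := (innerₛₗ ℂ w).smulRight v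

/-- The orthogonal projection `x ↦ ⟨v, x⟩ v` onto the line of a unit vector `v`. -/
def proj (v : E) : Module.End ℂ E := ketBra v v

/-- The product `X_{u(1)} X_{u(2)} ⋯ X_{u(n)}`. -/
def word (X : Fin d → Module.End ℂ E) (u : List (Fin d)) : Module.End ℂ E := (u.map X).prod

/-- The functional `φ` is represented on the Hilbert space `𝓗` by the operators `X_i` and the unit
vector `v`, that is `φ[x_u] = ⟨v, X_u v⟩`. The `X_i` are symmetric operators on a common invariant
dense domain containing `v`; this domain is the image of `E` under the isometry `J`. -/
structure IsRepresentedOn (φ : Functional d) (J : E →ₗᵢ[ℂ] 𝓗) (X : Fin d → Module.End ℂ E)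
    (v : E) : Prop where
  denseRange : DenseRange J
  isSymmetric : ∀ i, (X i).IsSymmetric
  norm_eq_one : ‖v‖ = 1
  moment_eq : ∀ u, moment φ u = ⟪J v, J (word X u v)⟫_ℂ

end Operators

/-! ### Hilbert space tensor products -/

section HilbertTensor

variable {E E' F F' : Type*} [NormedAddCommGroup E] [InnerProductSpace ℂ E]
  [NormedAddCommGroup E'] [InnerProductSpace ℂ E']
  [NormedAddCommGroup F] [InnerProductSpace ℂ F] [NormedAddCommGroup F'] [InnerProductSpace ℂ F']

/-- The Hilbert space tensor product, the completion of the algebraic tensor product. -/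
abbrev HilbertTensor (E F : Type*) [NormedAddCommGroup E] [InnerProductSpace ℂ E]
    [NormedAddCommGroup F] [InnerProductSpace ℂ F] : Type _ :=
  UniformSpace.Completion (E ⊗[ℂ] F)

/-- The inclusion of the algebraic tensor product of two domains. -/
def HilbertTensor.incl (J : E →ₗᵢ[ℂ] F) (J' : E' →ₗᵢ[ℂ] F') :
    E ⊗[ℂ] E' →ₗᵢ[ℂ] HilbertTensor F F' :=
  UniformSpace.Completion.toComplₗᵢ.comp (TensorProduct.mapIsometry J J')

end HilbertTensor

/-! ### Boolean Fock spaces -/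

section BooleanFock

variable {E F : Type*} [NormedAddCommGroup E] [InnerProductSpace ℂ E]
  [NormedAddCommGroup F] [InnerProductSpace ℂ F]

/-- The Boolean Fock space `ℂΩ ⊕ E`. -/
abbrev BooleanFock (E : Type*) : Type _ := WithLp 2 (ℂ × E)

namespace BooleanFock

/-- The inclusion of `E` into `ℂΩ ⊕ E`. -/
def of (x : E) : BooleanFock E := WithLp.toLp 2 (0, x)

/-- The vacuum vector `Ω`. -/
def vacuum (E : Type*) [NormedAddCommGroup E] : BooleanFock E := WithLp.toLp 2 (1, 0)

/-- The creation operator `x ↦ ⟨Ω, x⟩ ζ`. -/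
def create (ζ : E) : Module.End ℂ (BooleanFock E) := ketBra (of ζ) (vacuum E)

/-- The annihilation operator `x ↦ ⟨ζ, x⟩ Ω`. -/
def annihilate (ζ : E) : Module.End ℂ (BooleanFock E) := ketBra (vacuum E) (of ζ)

/-- The extension of an operator `S` on `E` to `ℂΩ ⊕ E` by `S Ω = 0`. -/
def extend (S : Module.End ℂ E) : Module.End ℂ (BooleanFock E) where
  toFun x := of (S x.snd)
  map_add' x y := by
    apply (WithLp.ofLp_injective 2)
    ext <;> simp [of]
  map_smul' c x := by
    apply (WithLp.ofLp_injective 2)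
    ext <;> simp [of]

/-- The inclusion of the Boolean Fock space over a domain. -/
def incl (J : E →ₗᵢ[ℂ] F) : BooleanFock E →ₗᵢ[ℂ] BooleanFock F where
  toFun x := WithLp.toLp 2 (x.fst, J x.snd)
  map_add' x y := by
    apply (WithLp.ofLp_injective 2)
    ext <;> simp
  map_smul' c x := by
    apply (WithLp.ofLp_injective 2)
    ext <;> simp
  norm_map' x := by simp [WithLp.prod_norm_eq_of_L2]

/-- The operators `a^{b,+}_{ζ_i} + a^{b,-}_{ζ_i} + S_i + α_i P_Ω`. -/
def op (ζ : Fin d → E) (S : Fin d → Module.End ℂ E) (α : Fin d → ℝ) (i : Fin d) :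
    Module.End ℂ (BooleanFock E) :=
  create (ζ i) + annihilate (ζ i) + extend (S i) + (α i : ℂ) • proj (vacuum E)

end BooleanFock

end BooleanFock

/-! ### Full Fock spaces -/

/-- A complex inner product space, bundled. -/
structure PreHilbert : Type (u + 1) where
  carrier : Type u
  [group : NormedAddCommGroup carrier]
  [inner : InnerProductSpace ℂ carrier]

attribute [instance] PreHilbert.group PreHilbert.inner

/-- Algebraic tensor powers, `E^{⊗ 0} = ℂ` (in the universe of `E`), `E^{⊗ (n+1)} = E ⊗ E^{⊗ n}`. -/
def tensorPower (E : Type u) [NormedAddCommGroup E] [InnerProductSpace ℂ E] : ℕ → PreHilbert.{u}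
  | 0 => ⟨EuclideanSpace ℂ PUnit.{u + 1}⟩
  | n + 1 => ⟨E ⊗[ℂ] (tensorPower E n).carrier⟩

/-- The algebraic tensor power `E^{⊗ n}`. -/
abbrev TPow (E : Type u) [NormedAddCommGroup E] [InnerProductSpace ℂ E] (n : ℕ) : Type u :=
  (tensorPower E n).carrier

section FullFock

variable {E : Type u} [NormedAddCommGroup E] [InnerProductSpace ℂ E]
  {F : Type v} [NormedAddCommGroup F] [InnerProductSpace ℂ F]

/-- The identity `E ⊗ E^{⊗ n} = E^{⊗ (n+1)}`. -/
def TPow.consEquiv (E : Type u) [NormedAddCommGroup E] [InnerProductSpace ℂ E] (n : ℕ) :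
    E ⊗[ℂ] TPow E n ≃ₗᵢ[ℂ] TPow E (n + 1) :=
  LinearIsometryEquiv.refl ℂ (E ⊗[ℂ] TPow E n)

/-- The identity `ℂ = E^{⊗ 0}`. -/
def TPow.zeroEquiv (E : Type u) [NormedAddCommGroup E] [InnerProductSpace ℂ E] :
    EuclideanSpace ℂ PUnit.{u + 1} ≃ₗᵢ[ℂ] TPow E 0 :=
  LinearIsometryEquiv.refl ℂ (EuclideanSpace ℂ PUnit.{u + 1})

/-- The map `J^{⊗ n}`. -/
def TPow.map (J : E →ₗᵢ[ℂ] F) : (n : ℕ) → TPow E n →ₗᵢ[ℂ] TPow F n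
  | 0 => ((TPow.zeroEquiv E).symm.trans
      ((LinearIsometryEquiv.piLpCongrLeft 2 ℂ ℂ (Equiv.equivPUnit PUnit.{u + 1})).trans
        (TPow.zeroEquiv F))).toLinearIsometry
  | n + 1 => (TPow.consEquiv F n).toLinearIsometry.comp
      ((TensorProduct.mapIsometry J (TPow.map J n)).comp
        (TPow.consEquiv E n).symm.toLinearIsometry)

/-- The algebraic full Fock space `ℂΩ ⊕ ⨁_{n ≥ 1} E^{⊗ n}`. -/
def AlgFock (E : Type u) [NormedAddCommGroup E] [InnerProductSpace ℂ E] : Type u :=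
  ⨁ n, TPow E n

instance : AddCommGroup (AlgFock E) := inferInstanceAs (AddCommGroup (⨁ n, TPow E n))

instance : Module ℂ (AlgFock E) := inferInstanceAs (Module ℂ (⨁ n, TPow E n))

namespace AlgFock

/-- The component in `E^{⊗ n}`. -/
def component (n : ℕ) : AlgFock E →ₗ[ℂ] TPow E n := DirectSum.component ℂ ℕ (fun n => TPow E n) n

/-- The inclusion of `E^{⊗ n}`. -/
def of (n : ℕ) : TPow E n →ₗ[ℂ] AlgFock E := DirectSum.lof ℂ ℕ (fun n => TPow E n) n

theorem component_of_self (n : ℕ) (x : TPow E n) : component n (of n x) = x :=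
  DirectSum.component.lof_self ℂ (M := fun n => TPow E n) n x

theorem component_of_ne {m n : ℕ} (h : m ≠ n) (x : TPow E m) : component n (of m x) = 0 :=
  (DirectSum.component.of ℂ (M := fun n => TPow E n) n m x).trans (dif_neg h)

theorem hom_ext {V : Type*} [AddCommGroup V] [Module ℂ V] {f g : AlgFock E →ₗ[ℂ] V}
    (h : ∀ n x, f (of n x) = g (of n x)) : f = g :=
  DirectSum.linearMap_ext ℂ fun n => LinearMap.ext fun x => h n x

/-- The linear map on `ℂΩ ⊕ ⨁_{n ≥ 1} E^{⊗ n}` with given restrictions to the summands. -/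
def lift {V : Type*} [AddCommGroup V] [Module ℂ V] (f : (n : ℕ) → TPow E n →ₗ[ℂ] V) :
    AlgFock E →ₗ[ℂ] V :=
  DirectSum.toModule ℂ ℕ V f

theorem lift_of {V : Type*} [AddCommGroup V] [Module ℂ V] (f : (n : ℕ) → TPow E n →ₗ[ℂ] V)
    (n : ℕ) (x : TPow E n) : lift f (of n x) = f n x :=
  DirectSum.toModule_lof ℂ (M := fun n => TPow E n) n x

theorem finite_support (x : AlgFock E) : {n | component n x ≠ 0}.Finite :=
  DFinsupp.finite_support (β := fun n => TPow E n) x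

theorem finite_support_inner (x y : AlgFock E) :
    (Function.support fun n => ⟪component n x, component n y⟫_ℂ).Finite :=
  (finite_support x).subset fun n hn h => hn (by simp [h])

/-- The inner product for which the tensor powers are orthogonal. -/
abbrev core : InnerProductSpace.Core ℂ (AlgFock E) where
  inner x y := ∑ᶠ n, ⟪component n x, component n y⟫_ℂ
  conj_inner_symm x y := by
    rw [map_finsum _ (finite_support_inner y x)]
    simp
  re_inner_nonneg x := by
    have := map_finsum Complex.reAddGroupHom (finite_support_inner x x)
    simp only [Complex.coe_reAddGroupHom] at this
    change 0 ≤ (∑ᶠ n, ⟪component n x, component n x⟫_ℂ).re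
    rw [this]
    exact finsum_nonneg fun n => inner_self_nonneg (𝕜 := ℂ)
  add_left x y z := by
    rw [← finsum_add_distrib (finite_support_inner x z) (finite_support_inner y z)]
    simp
  smul_left x y r := by
    rw [← smul_eq_mul, smul_finsum]
    simp [mul_comm]
  definite x hx := by
    have h := map_finsum Complex.reAddGroupHom (finite_support_inner x x)
    change (∑ᶠ n, ⟪component n x, component n x⟫_ℂ) = 0 at hx
    rw [hx] at h
    refine DFinsupp.ext (β := fun n => TPow E n) fun n => ?_
    by_contra hn
    have hpos : 0 < ∑ᶠ n, (⟪component n x, component n x⟫_ℂ).re :=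
      finsum_pos (fun n => inner_self_nonneg (𝕜 := ℂ))
        ⟨n, by
          have : component n x ≠ 0 := hn
          rw [inner_self_eq_norm_sq_to_K]
          norm_cast
          exact pow_pos (norm_pos_iff.mpr this) 2⟩
        ((finite_support x).subset fun n hn h => hn (by simp [h]))
    simp only [Complex.coe_reAddGroupHom, Complex.zero_re] at h
    exact hpos.ne h

instance : NormedAddCommGroup (AlgFock E) := core.toNormedAddCommGroup

instance : InnerProductSpace ℂ (AlgFock E) := InnerProductSpace.ofCore core.toCore

theorem inner_def (x y : AlgFock E) : ⟪x, y⟫_ℂ = ∑ᶠ n, ⟪component n x, component n y⟫_ℂ := rfl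

/-- The vacuum vector `Ω`. -/
def vacuum (E : Type u) [NormedAddCommGroup E] [InnerProductSpace ℂ E] : AlgFock E :=
  of 0 (TPow.zeroEquiv E (EuclideanSpace.single PUnit.unit 1))

/-- The creation operator `x₁ ⊗ ⋯ ⊗ x_n ↦ ζ ⊗ x₁ ⊗ ⋯ ⊗ x_n`. -/
def create (ζ : E) : Module.End ℂ (AlgFock E) :=
  lift fun n => of (n + 1) ∘ₗ (TPow.consEquiv E n).toLinearEquiv.toLinearMap ∘ₗ
    TensorProduct.mk ℂ E (TPow E n) ζ

/-- The annihilation operator `x₁ ⊗ ⋯ ⊗ x_n ↦ ⟨ζ, x₁⟩ x₂ ⊗ ⋯ ⊗ x_n`, `Ω ↦ 0`. -/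
def annihilate (ζ : E) : Module.End ℂ (AlgFock E) :=
  lift fun
    | 0 => 0
    | n + 1 => of n ∘ₗ (TensorProduct.lid ℂ (TPow E n)).toLinearMap ∘ₗ
        (innerₛₗ ℂ ζ).rTensor (TPow E n) ∘ₗ (TPow.consEquiv E n).symm.toLinearEquiv.toLinearMap

/-- The gauge operator `p(H) : x₁ ⊗ ⋯ ⊗ x_n ↦ (H x₁) ⊗ x₂ ⊗ ⋯ ⊗ x_n`, `Ω ↦ 0`. -/
def gauge (H : Module.End ℂ E) : Module.End ℂ (AlgFock E) :=
  lift fun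
    | 0 => 0
    | n + 1 => of (n + 1) ∘ₗ (TPow.consEquiv E n).toLinearEquiv.toLinearMap ∘ₗ
        H.rTensor (TPow E n) ∘ₗ (TPow.consEquiv E n).symm.toLinearEquiv.toLinearMap

/-- The operators `a^{f,+}_{ζ_i} + a^{f,-}_{ζ_i} + p(H_i) + λ_i I`. -/
def op (ζ : Fin d → E) (H : Fin d → Module.End ℂ E) (lam : Fin d → ℝ) (i : Fin d) :
    Module.End ℂ (AlgFock E) :=
  create (ζ i) + annihilate (ζ i) + gauge (H i) + (lam i : ℂ) • 1

/-- The map `⨁ J^{⊗ n}`. -/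
def map (J : E →ₗᵢ[ℂ] F) : AlgFock E →ₗᵢ[ℂ] AlgFock F :=
  LinearMap.isometryOfInner (lift fun n => of n ∘ₗ (TPow.map J n).toLinearMap) fun x y => by
    have h : ∀ (n : ℕ) (x : AlgFock E),
        component n (lift (fun n => of n ∘ₗ (TPow.map J n).toLinearMap) x : AlgFock F) =
          TPow.map J n (component n x) := by
      intro n x
      have : component n ∘ₗ (lift (fun n => of n ∘ₗ (TPow.map J n).toLinearMap) :
          AlgFock E →ₗ[ℂ] AlgFock F) = (TPow.map J n).toLinearMap ∘ₗ component n := by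
        refine hom_ext fun m z => ?_
        simp only [LinearMap.comp_apply, lift_of]
        by_cases hmn : m = n
        · subst hmn
          rw [component_of_self, component_of_self]
        · rw [component_of_ne hmn, component_of_ne hmn, map_zero]
      exact LinearMap.congr_fun this x
    rw [inner_def, inner_def]
    simp only [h, LinearIsometry.inner_map_map]

end AlgFock

/-- The full Fock space `𝓕(E)`, the completion of `ℂΩ ⊕ ⨁_{n ≥ 1} E^{⊗ n}`. -/
abbrev FullFock (E : Type u) [NormedAddCommGroup E] [InnerProductSpace ℂ E] : Type u :=
  UniformSpace.Completion (AlgFock E)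

/-- The inclusion of the algebraic full Fock space over a domain. -/
def FullFock.incl (J : E →ₗᵢ[ℂ] F) : AlgFock E →ₗᵢ[ℂ] FullFock F :=
  UniformSpace.Completion.toComplₗᵢ.comp (AlgFock.map J)

end FullFock

/-! ### The data representing states -/

section Data

/-- Data `(𝒦, ξ, K_i)`: a unit vector `ξ` and symmetric operators `K_i` with a common invariant
dense domain `dom` containing `ξ`. -/
structure VectorData (d : ℕ) (𝒦 : Type u) [NormedAddCommGroup 𝒦] [InnerProductSpace ℂ 𝒦] where
  dom : Submodule ℂ 𝒦
  dense : Dense (dom : Set 𝒦)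
  ξ : dom
  norm_ξ : ‖ξ‖ = 1
  K : Fin d → Module.End ℂ dom
  symm : ∀ i, (K i).IsSymmetric

/-- Data `(ℋ, ζ_i, H_i, λ_i)`: vectors `ζ_i`, symmetric operators `H_i` with a common invariant
dense domain `dom` containing the `ζ_i`, and real numbers `λ_i`. -/
structure FockData (d : ℕ) (ℋ : Type u) [NormedAddCommGroup ℋ] [InnerProductSpace ℂ ℋ] where
  dom : Submodule ℂ ℋ
  dense : Dense (dom : Set ℋ)
  ζ : Fin d → dom
  H : Fin d → Module.End ℂ dom
  symm : ∀ i, (H i).IsSymmetric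
  lam : Fin d → ℝ

variable {𝒦 : Type u} [NormedAddCommGroup 𝒦] [InnerProductSpace ℂ 𝒦]
  {ℋ : Type v} [NormedAddCommGroup ℋ] [InnerProductSpace ℂ ℋ]

/-- `ψ[x_u] = ⟨ξ, K_u ξ⟩`. -/
def VectorData.Represents (A : VectorData d 𝒦) (ψ : Functional d) : Prop :=
  IsRepresentedOn ψ A.dom.subtypeₗᵢ A.K A.ξ

/-- `φ[x_u] = ⟨Ω, (a^{b,+}_{ε_i} + a^{b,-}_{ε_i} + S_i + α_i P_Ω)_u Ω⟩` on the Boolean Fock space,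
where the data are `(ε_i, S_i, α_i)`. -/
def FockData.BooleanRepresents (B : FockData d ℋ) (φ : Functional d) : Prop :=
  IsRepresentedOn φ (BooleanFock.incl B.dom.subtypeₗᵢ) (BooleanFock.op B.ζ B.H B.lam)
    (BooleanFock.vacuum B.dom)

/-- `ρ[x_u] = ⟨Ω, (a^{f,+}_{ζ_i} + a^{f,-}_{ζ_i} + p(H_i) + λ_i I)_u Ω⟩` on the full Fock space. -/
def FockData.FreeRepresents (B : FockData d ℋ) (ρ : Functional d) : Prop :=
  IsRepresentedOn ρ (FullFock.incl B.dom.subtypeₗᵢ) (AlgFock.op B.ζ B.H B.lam)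
    (AlgFock.vacuum B.dom)

/-- The inclusion of the algebraic tensor product of the domains into `𝒦 ⊗ ℋ`. -/
def tensorIncl (A : VectorData d 𝒦) (B : FockData d ℋ) :
    A.dom ⊗[ℂ] B.dom →ₗᵢ[ℂ] HilbertTensor 𝒦 ℋ :=
  HilbertTensor.incl A.dom.subtypeₗᵢ B.dom.subtypeₗᵢ

/-- The vectors `ξ ⊗ ζ_i`. -/
def tensorVec (A : VectorData d 𝒦) (B : FockData d ℋ) (i : Fin d) : A.dom ⊗[ℂ] B.dom :=
  A.ξ ⊗ₜ[ℂ] B.ζ i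

/-- The operators `K_i ⊗ I + P_ξ ⊗ H_i`. -/
def tensorOp (A : VectorData d 𝒦) (B : FockData d ℋ) (i : Fin d) :
    Module.End ℂ (A.dom ⊗[ℂ] B.dom) :=
  TensorProduct.map (A.K i) LinearMap.id + TensorProduct.map (proj A.ξ) (B.H i)

/-- The inclusion of the domain into `𝓕(𝒦 ⊗ ℋ) ⊗ 𝒦`. -/
def convIncl (A : VectorData d 𝒦) (B : FockData d ℋ) :
    AlgFock (A.dom ⊗[ℂ] B.dom) ⊗[ℂ] A.dom →ₗᵢ[ℂ]
      HilbertTensor (FullFock (HilbertTensor 𝒦 ℋ)) 𝒦 :=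
  HilbertTensor.incl (FullFock.incl (tensorIncl A B)) A.dom.subtypeₗᵢ

/-- The action of `K_i` on the leftmost factor `𝒦` of each summand of
`𝓕(𝒦 ⊗ ℋ) ⊗ 𝒦 = 𝒦 ⊕ ⨁_{n ≥ 1} (𝒦 ⊗ ℋ)^{⊗ n} ⊗ 𝒦`: it is `K_i` on the summand `𝒦`
and `p(K_i ⊗ I) ⊗ I` on the other ones. -/
def leftK (A : VectorData d 𝒦) (B : FockData d ℋ) (i : Fin d) :
    Module.End ℂ (AlgFock (A.dom ⊗[ℂ] B.dom) ⊗[ℂ] A.dom) :=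
  TensorProduct.map (proj (AlgFock.vacuum (A.dom ⊗[ℂ] B.dom))) (A.K i) +
    TensorProduct.map (AlgFock.gauge (TensorProduct.map (A.K i) LinearMap.id)) LinearMap.id

/-- The operators
`a^{f,+}_{ξ ⊗ ζ_i} ⊗ I + a^{f,-}_{ξ ⊗ ζ_i} ⊗ I + p(K_i ⊗ I) ⊗ I + p(P_ξ ⊗ H_i) ⊗ I + λ_i I`
on `𝓕(𝒦 ⊗ ℋ) ⊗ 𝒦`, where the third term is understood as in `leftK`. -/
def convOp (A : VectorData d 𝒦) (B : FockData d ℋ) (i : Fin d) :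
    Module.End ℂ (AlgFock (A.dom ⊗[ℂ] B.dom) ⊗[ℂ] A.dom) :=
  TensorProduct.map (AlgFock.create (tensorVec A B i)) LinearMap.id +
    TensorProduct.map (AlgFock.annihilate (tensorVec A B i)) LinearMap.id +
    leftK A B i +
    TensorProduct.map (AlgFock.gauge (TensorProduct.map (proj A.ξ) (B.H i))) LinearMap.id +
    (B.lam i : ℂ) • 1

end Data

end TwoState

end

noncomputable section

namespace TwoState

namespace NCSeries

variable {d : ℕ}

/-! ### The algebra of non-commutative power series -/

/-! Everything is reduced to identities between power series. Write m for the full moment series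
`moment φ` of a unital functional. Boolean cumulants are then characterised by m = 1 + η m and free
cumulants by m = 1 + R(m z), each equation having a unique solution m. To prove that a family of
operators represents a functional, it therefore suffices to show that its vacuum series solves the
right equation.

A vector-operator-scalar triple (ζ, H, λ) carries a single series, `fockCumulants`, with
coefficients λ_i and ⟨ζ_i, H_u ζ_j⟩. It is the Boolean cumulant series of the Boolean Fock model and
the free cumulant series of the full Fock model. Part (b) follows at once, and rescaling ζ by √t and
λ by t multiplies the series by t, which gives free infinite divisibility. For the operators K_i ⊗ I
+ P_ξ ⊗ H_i and vectors ξ ⊗ ζ_i the series becomes Σ z_i (D_i R^ρ)(m z), with m the moments of ψ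
(`fockCumulants_tensor`). This is exactly η^{Φ[ρ, ψ]}, which gives (a) and the model in (d).

The algebraic core of (c) and (d) is subordination: with B the moment series of 𝔹[Φ[ρ, ψ]], the
moments of ψ ⊞ ρ are m(B z) B (`moment_freeConv`). The operators on 𝓕(𝒦 ⊗ ℋ) ⊗ 𝒦 have the form T_i ⊗
I + P_Ω ⊗ K_i, where T_i is the model of B, and `matrixSeries_tensor_vacuum` computes their series
to be m(B z) B as well.

Positivity always comes from a representation. The data come from GNS-type constructions: on φ
itself for the vector data, on φ compressed to centred polynomials for the Boolean data, and on the
cumulant functional for the free data. The last is positive on polynomials without constant term, as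
the derivative of ρ^{⊞ t} at t = 0 (`cumulantFunctional_nonneg`). -/

theorem mul_nil (f g : NCSeries d) : mul f g [] = f [] * g [] := by simp [mul]

theorem mul_apply_cons (f g : NCSeries d) (i : Fin d) (u : List (Fin d)) :
    mul f g (i :: u) = f [] * g (i :: u) + mul (D i f) g u := by
  simp [mul, D, Finset.sum_range_succ' _ (u.length + 1)]
  ring

/-- The Leibniz rule for the left derivative. It lets identities between products be proved by
induction on the word, with the left factor generalised. -/
theorem D_mul (i : Fin d) (f g : NCSeries d) :
    D i (mul f g) = f [] • D i g + mul (D i f) g :=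
  funext fun u => mul_apply_cons f g i u

theorem mul_add (f g h : NCSeries d) : mul f (g + h) = mul f g + mul f h := by
  funext u; simp [mul, _root_.mul_add, Finset.sum_add_distrib]

theorem add_mul (f g h : NCSeries d) : mul (f + g) h = mul f h + mul g h := by
  funext u; simp [mul, _root_.add_mul, Finset.sum_add_distrib]

theorem mul_sub (f g h : NCSeries d) : mul f (g - h) = mul f g - mul f h := by
  funext u; simp [mul, _root_.mul_sub, Finset.sum_sub_distrib]

theorem smul_mul (c : ℂ) (f g : NCSeries d) : mul (c • f) g = c • mul f g := by
  funext u; simp [mul, Finset.mul_sum, mul_assoc]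

theorem mul_smul (c : ℂ) (f g : NCSeries d) : mul f (c • g) = c • mul f g := by
  funext u; simp [mul, Finset.mul_sum, mul_left_comm]

theorem D_one (i : Fin d) : D i (one : NCSeries d) = 0 := by
  funext u; simp [D, one]

theorem zero_mul (f : NCSeries d) : mul 0 f = 0 := by
  funext u; simp [mul]

theorem one_mul (f : NCSeries d) : mul one f = f := by
  funext u
  cases u with
  | nil => simp [mul_nil, one]
  | cons i u => rw [mul_apply_cons, D_one, zero_mul]; simp [one]

theorem mul_one (f : NCSeries d) : mul f one = f := by
  funext u
  induction u generalizing f with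
  | nil => simp [mul_nil, one]
  | cons i u ih => rw [mul_apply_cons, ih]; simp [one, D]

theorem mul_assoc (f g h : NCSeries d) : mul (mul f g) h = mul f (mul g h) := by
  funext u
  induction u generalizing f with
  | nil => simp [mul_nil, _root_.mul_assoc]
  | cons i u ih =>
    rw [mul_apply_cons, mul_apply_cons, mul_apply_cons, D_mul, add_mul, smul_mul, Pi.add_apply,
      ih, mul_nil]
    simp only [Pi.smul_apply, smul_eq_mul]
    ring

theorem inv_nil (f : NCSeries d) : inv f [] = 1 := by rw [inv]

/-- Since `inv f` is built as a right inverse, a left inverse must coincide with it. This is what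
makes all inverses two-sided. -/
theorem eq_inv_of_mul_eq_one {f g : NCSeries d} (hf : f [] = 1) (h : mul g f = one) :
    g = inv f := by
  rw [← mul_one g, ← mul_inv f hf, ← mul_assoc, h, one_mul]

theorem inv_mul (f : NCSeries d) (hf : f [] = 1) : mul (inv f) f = one := by
  have h := eq_inv_of_mul_eq_one (inv_nil f) (mul_inv f hf)
  have h' := mul_inv (inv f) (inv_nil f)
  rwa [← h] at h'

theorem inv_inv (f : NCSeries d) (hf : f [] = 1) : inv (inv f) = f :=
  (eq_inv_of_mul_eq_one (inv_nil f) (mul_inv f hf)).symm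

theorem mul_left_cancel {f g h : NCSeries d} (hf : f [] = 1) (H : mul f g = mul f h) : g = h := by
  rw [← one_mul g, ← one_mul h, ← inv_mul f hf, mul_assoc, mul_assoc, H]

/-- The series `∑ i, z_i g_i`. -/
def cons (g : Fin d → NCSeries d) : NCSeries d
  | [] => 0
  | i :: u => g i u

theorem D_cons (g : Fin d → NCSeries d) (i : Fin d) : D i (cons g) = g i := rfl

theorem eq_add_cons (f : NCSeries d) : f = f [] • one + cons fun i => D i f := by
  funext u
  cases u <;> simp [one, cons, D]

theorem cons_mul (g : Fin d → NCSeries d) (h : NCSeries d) :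
    mul (cons g) h = cons fun i => mul (g i) h := by
  funext u
  cases u with
  | nil => simp [mul_nil, cons]
  | cons i u => rw [mul_apply_cons, D_cons]; simp [cons]

theorem cons_add (g h : Fin d → NCSeries d) :
    (cons fun i => g i + h i) = cons g + cons h := by
  funext u; cases u <;> simp [cons]

theorem cons_smul (c : ℂ) (g : Fin d → NCSeries d) :
    (cons fun i => c • g i) = c • cons g := by
  funext u; cases u <;> simp [cons]

theorem mul_cons_apply (A : NCSeries d) (g : Fin d → NCSeries d) (u : List (Fin d)) :
    mul A (cons g) u = ∑ k : Fin u.length, A (u.take k) * g (u.get k) (u.drop (k + 1)) := by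
  induction u generalizing A with
  | nil => simp [mul_nil, cons]
  | cons i u ih => rw [mul_apply_cons, ih]; simp [cons, D, Fin.sum_univ_succ]

/-- The coefficient of `∑ i, A z_i g_i` at `u` only involves the `g_i` on words shorter than `u`. -/
theorem mul_cons_congr {A : NCSeries d} {g h : Fin d → NCSeries d} (u : List (Fin d))
    (H : ∀ i v, v.length < u.length → g i v = h i v) :
    mul A (cons g) u = mul A (cons h) u := by
  rw [mul_cons_apply, mul_cons_apply]
  refine Finset.sum_congr rfl fun k _ => ?_
  have := k.isLt
  rw [H _ _ (by simp only [List.length_drop]; omega)]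

/-- Families of series satisfying the same recursion through `∑ i, A z_i (·)` agree. -/
theorem eq_of_recursion {ι : Type*} (A : NCSeries d) (G H : ι → NCSeries d)
    (Q : (ι → NCSeries d) → ι → Fin d → NCSeries d) (c : ι → NCSeries d)
    (hQ : ∀ n, (∀ k v, v.length < n → G k v = H k v) →
      ∀ k i v, v.length < n → Q G k i v = Q H k i v)
    (hG : ∀ k, G k = c k + mul A (cons (Q G k))) (hH : ∀ k, H k = c k + mul A (cons (Q H k))) :
    G = H := by
  have key : ∀ n k v, v.length < n → G k v = H k v := by
    intro n
    induction n with
    | zero => intro k v hv; omega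
    | succ n ih =>
      intro k v hv
      -- Each variable z_i uses up one letter, so only strictly shorter words of `Q` enter and the
      -- induction on length closes.
      rw [hG, hH, Pi.add_apply, Pi.add_apply, mul_cons_congr]
      exact fun i w hw => hQ n ih k i w (by omega)
  funext k v
  exact key _ k v (Nat.lt_succ_self _)

/-! ### Substitution -/

theorem subst_eq (A f : NCSeries d) :
    subst A f = f [] • one + mul A (cons fun i => subst A (D i f)) := by
  funext u
  rw [subst, Pi.add_apply, mul_cons_apply]
  simp [one]

theorem subst_nil (A f : NCSeries d) : subst A f [] = f [] := by rw [subst]; simp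

theorem subst_cons (A : NCSeries d) (g : Fin d → NCSeries d) :
    subst A (cons g) = mul A (cons fun i => subst A (g i)) := by
  rw [subst_eq]; simp [cons, D_cons]

/-- To recognise a substitution, it is enough to check its defining recursion for all series at
once, because each step replaces f by its derivatives. -/
theorem subst_eq_of_recursion {A : NCSeries d} (G : NCSeries d → NCSeries d)
    (hG : ∀ f, G f = f [] • one + mul A (cons fun i => G (D i f))) (f : NCSeries d) :
    subst A f = G f :=
  congrFun (eq_of_recursion A (subst A) G (fun G f i => G (D i f)) (fun f => f [] • one)
    (fun _ h _ _ _ hv => h _ _ hv) (subst_eq A) hG) f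

theorem subst_add (A f g : NCSeries d) : subst A (f + g) = subst A f + subst A g := by
  -- The family is indexed by pairs because the recursion differentiates both series simultaneously.
  have key := eq_of_recursion A (fun p : NCSeries d × NCSeries d => subst A (p.1 + p.2))
    (fun p => subst A p.1 + subst A p.2) (fun G p i => G (D i p.1, D i p.2))
    (fun p => (p.1 + p.2) [] • one) (fun _ h _ _ _ hv => h _ _ hv)
    (fun p => subst_eq A (p.1 + p.2))
    (fun p => by
      rw [subst_eq A p.1, subst_eq A p.2, cons_add, mul_add, Pi.add_apply, add_smul]; abel)
  exact congrFun key (f, g)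

theorem subst_smul (A : NCSeries d) (c : ℂ) (f : NCSeries d) :
    subst A (c • f) = c • subst A f := by
  have key := eq_of_recursion A (fun f : NCSeries d => subst A (c • f))
    (fun f => c • subst A f) (fun G f i => G (D i f))
    (fun f => (c • f) [] • one) (fun _ h _ _ _ hv => h _ _ hv)
    (fun f => subst_eq A (c • f))
    (fun f => by
      rw [subst_eq A f, cons_smul, mul_smul, smul_add, smul_smul, Pi.smul_apply, smul_eq_mul])
  exact congrFun key f

theorem subst_zero (A : NCSeries d) : subst A 0 = 0 := by
  simpa using subst_smul A 0 0

theorem subst_one (A : NCSeries d) : subst A one = one := by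
  have h : (cons fun _ : Fin d => (0 : NCSeries d)) = (0 : ℂ) • cons fun _ => 0 := by
    rw [← cons_smul]; simp
  rw [subst_eq]
  simp only [D_one, subst_zero]
  rw [h, mul_smul]
  simp [one]

/-- Substitution is multiplicative. -/
theorem subst_mul (A f g : NCSeries d) : subst A (mul f g) = mul (subst A f) (subst A g) := by
  -- Here g is fixed and f varies; the extra term f(0) (D_i g)(A z) comes from the Leibniz rule.
  have key := eq_of_recursion A (fun f : NCSeries d => subst A (mul f g))
    (fun f => mul (subst A f) (subst A g))
    (fun G f i => f [] • subst A (D i g) + G (D i f))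
    (fun f => (mul f g) [] • one) (fun _ h _ _ _ hv => by simp [h _ _ hv])
    (fun f => by
      rw [subst_eq A (mul f g)]
      simp only [D_mul, subst_add, subst_smul])
    (fun f => by
      conv_lhs => rw [subst_eq A f, add_mul, smul_mul, one_mul, mul_assoc, cons_mul]
      rw [cons_add, cons_smul, mul_add, mul_smul, mul_nil]
      -- Only the summand f(0) g(A z) is expanded, which yields the extra Leibniz term on this side.
      conv_lhs => enter [1]; rw [subst_eq A g]
      rw [smul_add, smul_smul, add_assoc])
  exact congrFun key f

/-- `f(a z)` at `B z` is `f(a(B z) B z)`. -/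
theorem subst_subst (B a f : NCSeries d) :
    subst B (subst a f) = subst (mul (subst B a) B) f := by
  -- As a function of f, the left side satisfies the recursion with multiplier a(B z) B.
  refine (subst_eq_of_recursion (fun f => subst B (subst a f)) (fun f => ?_) f).symm
  conv_lhs => rw [subst_eq a f, subst_add, subst_smul, subst_one, subst_mul, subst_cons]
  rw [mul_assoc]

end NCSeries

end TwoState
end

noncomputable section

namespace TwoState

open NCSeries

variable {d : ℕ}

/-! ### Functionals and their cumulants -/

theorem moment_nil (φ : Functional d) : moment φ [] = φ 1 := rfl

theorem Functional.ext_moment {φ ψ : Functional d} (h : moment φ = moment ψ) : φ = ψ := by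
  refine MonoidAlgebra.lhom_ext' fun u => LinearMap.ext_ring ?_
  exact congrFun h u.toList

theorem one_add_momentSeries {φ : Functional d} (h : φ 1 = 1) :
    one + momentSeries φ = moment φ := by
  funext u
  by_cases hu : u = []
  · simp [hu, one, momentSeries, moment_nil, h]
  · simp [hu, one, momentSeries]

theorem freeCumulants_nil (φ : Functional d) : freeCumulants φ [] = 0 :=
  (existsUnique_cumulants (momentSeries φ) (momentSeries_nil φ)).choose_spec.1.1

/-- As R(0) = 0, the equation extends to the empty word, so it can be used as an identity of series.
-/
theorem moment_eq_subst_freeCumulants {φ : Functional d} (h : φ 1 = 1) :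
    moment φ = one + subst (moment φ) (freeCumulants φ) := by
  have hs : ∀ u, u ≠ [] → momentSeries φ u = subst (one + momentSeries φ) (freeCumulants φ) u :=
    (existsUnique_cumulants (momentSeries φ) (momentSeries_nil φ)).choose_spec.1.2
  funext u
  by_cases hu : u = []
  · subst hu
    simp [subst_nil, freeCumulants_nil, one, moment_nil, h]
  · have := hs u hu
    rw [one_add_momentSeries h] at this
    simpa [one, hu, momentSeries] using this

theorem freeCumulants_eq {φ : Functional d} {R : NCSeries d} (h : φ 1 = 1) (hR : R [] = 0)
    (hm : moment φ = one + subst (moment φ) R) : freeCumulants φ = R := by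
  refine ((existsUnique_cumulants (momentSeries φ) (momentSeries_nil φ)).choose_spec.2 R
    ⟨hR, fun u hu => ?_⟩).symm
  rw [one_add_momentSeries h]
  have := congrFun hm u
  simpa [one, hu, momentSeries] using this

theorem moment_ofFreeCumulants {R : NCSeries d} (hR : R [] = 0) :
    moment (ofFreeCumulants R) = one + subst (moment (ofFreeCumulants R)) R := by
  have hs := (existsUnique_moments R).choose_spec.1
  have hm : moment (ofFreeCumulants R) = one + (existsUnique_moments R).choose :=
    funext fun u => moment_ofMoments _ u
  rw [hm]
  congr 1
  funext u
  by_cases hu : u = []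
  · rw [hu, hs.1, subst_nil, hR]
  · exact hs.2 u hu

theorem ofFreeCumulants_one {R : NCSeries d} (hR : R [] = 0) : ofFreeCumulants R 1 = 1 := by
  rw [← moment_nil, moment_ofFreeCumulants hR]
  simp [one, subst_nil, hR]

/-- Uniqueness of the solution of the moment-cumulant equation; this is how a computed series is
identified with the moments of a functional. -/
theorem eq_moment_ofFreeCumulants {R m : NCSeries d} (hR : R [] = 0)
    (hm : m = one + subst m R) : m = moment (ofFreeCumulants R) := by
  have h1 : m [] = 1 := by rw [hm]; simp [one, subst_nil, hR]
  have h := (existsUnique_moments R).choose_spec.2 (m - one)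
    ⟨by simp [h1, one], fun u hu => ?_⟩
  · rw [ofFreeCumulants]
    funext u
    rw [moment_ofMoments, ← h]
    simp
  · rw [add_sub_cancel]
    have := congrFun hm u
    simpa [one, hu] using this

theorem freeCumulants_ofFreeCumulants {R : NCSeries d} (hR : R [] = 0) :
    freeCumulants (ofFreeCumulants R) = R :=
  freeCumulants_eq (ofFreeCumulants_one hR) hR (moment_ofFreeCumulants hR)

/-! ### Boolean cumulants -/

theorem booleanCumulants_nil (φ : Functional d) : booleanCumulants φ [] = 0 := by
  simp [booleanCumulants, one, inv_nil]

theorem moment_eq_mul_booleanCumulants {φ : Functional d} (h : φ 1 = 1) :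
    moment φ = one + mul (booleanCumulants φ) (moment φ) := by
  have h1 := inv_mul (moment φ) h
  have h2 : mul (one - inv (moment φ)) (moment φ) + mul (inv (moment φ)) (moment φ) = moment φ := by
    rw [← add_mul, sub_add_cancel, one_mul]
  rw [booleanCumulants, one_add_momentSeries h]
  rw [h1] at h2
  rw [add_comm, h2]

theorem booleanCumulants_eq {φ : Functional d} {η : NCSeries d} (h : φ 1 = 1)
    (hm : moment φ = one + mul η (moment φ)) : booleanCumulants φ = η := by
  have h1 : mul (one - η) (moment φ) = one := by
    have : mul (one - η) (moment φ) + mul η (moment φ) = moment φ := by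
      rw [← add_mul, sub_add_cancel, one_mul]
    rw [eq_sub_of_add_eq this, sub_eq_iff_eq_add]
    exact hm
  rw [booleanCumulants, one_add_momentSeries h, ← eq_inv_of_mul_eq_one h h1, sub_sub_cancel]

theorem moment_ofBooleanCumulants (η : NCSeries d) :
    moment (ofBooleanCumulants η) = inv (one - η) :=
  funext fun u => moment_ofMoments _ u

theorem ofBooleanCumulants_one (η : NCSeries d) : ofBooleanCumulants η 1 = 1 := by
  rw [← moment_nil, moment_ofBooleanCumulants, inv_nil]

theorem booleanCumulants_ofBooleanCumulants {η : NCSeries d} (hη : η [] = 0) :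
    booleanCumulants (ofBooleanCumulants η) = η := by
  rw [booleanCumulants, one_add_momentSeries (ofBooleanCumulants_one η),
    moment_ofBooleanCumulants, inv_inv _ (by simp [one, hη]), sub_sub_cancel]

/-- The Boolean cumulants of `Φ[ρ, ψ]`. -/
def phiCumulants (ρ ψ : Functional d) : NCSeries d :=
  mul (inv (moment ψ)) (subst (moment ψ) (freeCumulants ρ))

theorem phiCumulants_nil (ρ ψ : Functional d) : phiCumulants ρ ψ [] = 0 := by
  simp [phiCumulants, mul_nil, subst_nil, freeCumulants_nil]

/-- Having no constant term, R^ρ(m z) equals m Σ z_i (D_i R^ρ)(m z), and the leading m cancels. The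
tensor model produces the cumulants in this form. -/
theorem phiCumulants_eq_cons (ρ : Functional d) {ψ : Functional d} (h : ψ 1 = 1) :
    phiCumulants ρ ψ = cons fun i => subst (moment ψ) (D i (freeCumulants ρ)) := by
  rw [phiCumulants, subst_eq, freeCumulants_nil, zero_smul, zero_add, ← mul_assoc, inv_mul _ h,
    one_mul]

theorem Phi_eq (ρ : Functional d) {ψ : Functional d} (h : ψ 1 = 1) :
    Phi ρ ψ = ofBooleanCumulants (phiCumulants ρ ψ) := by
  rw [Phi, one_add_momentSeries h]; rfl

theorem Phi_one (ρ ψ : Functional d) : Phi ρ ψ 1 = 1 := ofBooleanCumulants_one _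

theorem booleanCumulants_Phi (ρ : Functional d) {ψ : Functional d} (h : ψ 1 = 1) :
    booleanCumulants (Phi ρ ψ) = phiCumulants ρ ψ := by
  rw [Phi_eq ρ h, booleanCumulants_ofBooleanCumulants (phiCumulants_nil ρ ψ)]

theorem freeCumulants_BercoviciPata (φ : Functional d) :
    freeCumulants (BercoviciPata φ) = booleanCumulants φ :=
  freeCumulants_ofFreeCumulants (booleanCumulants_nil φ)

theorem BercoviciPata_one (φ : Functional d) : BercoviciPata φ 1 = 1 :=
  ofFreeCumulants_one (booleanCumulants_nil φ)

theorem freeConv_one (φ ψ : Functional d) : freeConv φ ψ 1 = 1 :=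
  ofFreeCumulants_one (by simp [freeCumulants_nil])

theorem moment_BercoviciPata_Phi (ρ : Functional d) {ψ : Functional d} (h : ψ 1 = 1) :
    moment (BercoviciPata (Phi ρ ψ)) =
      one + subst (moment (BercoviciPata (Phi ρ ψ))) (phiCumulants ρ ψ) := by
  have := moment_eq_subst_freeCumulants (BercoviciPata_one (Phi ρ ψ))
  rwa [freeCumulants_BercoviciPata, booleanCumulants_Phi ρ h] at this

/-- The identity m η = R^ρ(m z) evaluated at B z, using that substitution is multiplicative and
composes. -/
theorem subst_mul_phiCumulants (ρ : Functional d) {ψ : Functional d} (h : ψ 1 = 1)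
    (B : NCSeries d) :
    mul (subst B (moment ψ)) (subst B (phiCumulants ρ ψ)) =
      subst (mul (subst B (moment ψ)) B) (freeCumulants ρ) := by
  rw [← subst_mul, phiCumulants, ← mul_assoc, NCSeries.mul_inv _ h, one_mul, subst_subst]

/-- Subordination: `1 + M^{ψ ⊞ ρ} = (1 + M^ψ)(B z) B` for `B = 1 + M^{𝔹[Φ[ρ, ψ]]}`. -/
theorem moment_freeConv (ρ : Functional d) {ψ : Functional d} (h : ψ 1 = 1) :
    moment (freeConv ψ ρ) = mul (subst (moment (BercoviciPata (Phi ρ ψ))) (moment ψ))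
      (moment (BercoviciPata (Phi ρ ψ))) := by
  have hB := moment_BercoviciPata_Phi ρ h
  set B := moment (BercoviciPata (Phi ρ ψ)) with hBdef
  refine (eq_moment_ofFreeCumulants (by simp [freeCumulants_nil]) ?_).symm
  -- With A = m(B z) B, composition gives R^ψ(A z) = m(B z) - 1, while R^ρ(A z) = m(B z) η(B z) =
  -- m(B z) (B - 1). Together with 1 they add up to A.
  rw [subst_add, ← subst_mul_phiCumulants ρ h, ← subst_subst, ← add_assoc]
  have h1 : subst B (moment ψ) = one + subst B (subst (moment ψ) (freeCumulants ψ)) := by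
    conv_lhs => rw [moment_eq_subst_freeCumulants h, subst_add, subst_one]
  rw [← h1]
  conv_lhs => enter [2]; rw [hB]
  rw [mul_add, mul_one]

/-- `𝔹[Φ[ρ, ψ]] = Φ[ρ, ψ ⊞ ρ]`. -/
theorem BercoviciPata_Phi (ρ : Functional d) {ψ : Functional d} (h : ψ 1 = 1) :
    BercoviciPata (Phi ρ ψ) = Phi ρ (freeConv ψ ρ) := by
  refine Functional.ext_moment ?_
  rw [Phi_eq ρ (freeConv_one ψ ρ), moment_ofBooleanCumulants]
  have hB := moment_BercoviciPata_Phi ρ h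
  have hA := moment_freeConv ρ h
  set B := moment (BercoviciPata (Phi ρ ψ)) with hBdef
  refine eq_inv_of_mul_eq_one (by simp [one, phiCumulants_nil]) ?_
  have h0 : subst B (moment ψ) [] = 1 := by rw [subst_nil, moment_nil, h]
  -- Let η' be the cumulants of Φ[ρ, ψ ⊞ ρ] and A = m(B z) B the moments of ψ ⊞ ρ. Then A η' = R^ρ(A
  -- z) = m(B z) η(B z), and m(B z) cancels. As η(B z) = B - 1, this says B (1 - η') = 1.
  have h1 : mul B (phiCumulants ρ (freeConv ψ ρ)) = subst B (phiCumulants ρ ψ) := by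
    refine mul_left_cancel h0 ?_
    rw [subst_mul_phiCumulants ρ h, ← mul_assoc, ← hA, phiCumulants, ← mul_assoc,
      NCSeries.mul_inv _ (freeConv_one ψ ρ), one_mul]
  rw [NCSeries.mul_sub, mul_one, h1, sub_eq_iff_eq_add]
  exact hB

end TwoState
end

noncomputable section

namespace TwoState

/-! ### Operators on the algebraic full Fock space -/

namespace AlgFock

variable {E : Type u} [NormedAddCommGroup E] [InnerProductSpace ℂ E]
  {F : Type v} [NormedAddCommGroup F] [InnerProductSpace ℂ F]

theorem create_of (e : E) (n : ℕ) (x : TPow E n) :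
    create e (of n x) = of (n + 1) (TPow.consEquiv E n (e ⊗ₜ x)) := by
  rw [create, lift_of]; rfl

theorem induction_of {p : AlgFock E → Prop} (add : ∀ x y, p x → p y → p (x + y))
    (h : ∀ n x, p (of n x)) (x : AlgFock E) : p x := by
  refine DirectSum.induction_on (β := fun n => TPow E n) (motive := p) x ?_ (fun n y => h n y)
    (fun x y hx hy => add x y hx hy)
  have := h 0 0
  rwa [map_zero] at this

theorem of_zero_eq (x : TPow E 0) : ∃ c : ℂ, of 0 x = c • vacuum E := by
  refine ⟨(TPow.zeroEquiv E).symm x PUnit.unit, ?_⟩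
  rw [vacuum, ← map_smul, ← map_smul]
  congr 1
  refine (TPow.zeroEquiv E).symm.injective ?_
  rw [LinearIsometryEquiv.symm_apply_apply]
  ext i
  simp

/-- Induction over the algebraic full Fock space: it is spanned by the vacuum vector and the
ranges of the creation operators. -/
theorem induction_create {p : AlgFock E → Prop} (x : AlgFock E)
    (add : ∀ x y, p x → p y → p (x + y)) (smul : ∀ (c : ℂ) x, p x → p (c • x))
    (vac : p (vacuum E)) (create : ∀ e x, p x → p (create e x)) : p x := by
  refine induction_of add (fun n => ?_) x
  induction n with
  | zero =>
    intro x
    obtain ⟨c, hc⟩ := of_zero_eq x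
    rw [hc]
    exact smul c _ vac
  | succ n ih =>
    intro x
    refine TensorProduct.induction_on (motive := fun y : E ⊗[ℂ] TPow E n =>
      p (of (n + 1) (TPow.consEquiv E n y))) ((TPow.consEquiv E n).symm x) ?_ ?_ ?_
    · have := smul 0 _ vac
      rw [zero_smul] at this
      simpa using this
    · intro e y
      rw [← create_of]
      exact create e _ (ih y)
    · intro y z hy hz
      rw [map_add, map_add]
      exact add _ _ hy hz

theorem annihilate_vacuum (ζ : E) : annihilate ζ (vacuum E) = 0 := by
  rw [annihilate, vacuum, lift_of]; rfl

theorem gauge_vacuum (H : Module.End ℂ E) : gauge H (vacuum E) = 0 := by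
  rw [gauge, vacuum, lift_of]; rfl

theorem annihilate_create (ζ e : E) (x : AlgFock E) :
    annihilate ζ (create e x) = ⟪ζ, e⟫_ℂ • x := by
  refine induction_of (p := fun x => annihilate ζ (create e x) = ⟪ζ, e⟫_ℂ • x)
    (fun x y hx hy => by rw [map_add, map_add, hx, hy, smul_add]) (fun n x => ?_) x
  rw [create_of, annihilate, lift_of, ← map_smul]
  simp

theorem gauge_create (H : Module.End ℂ E) (e : E) (x : AlgFock E) :
    gauge H (create e x) = create (H e) x := by
  refine induction_of (p := fun x => gauge H (create e x) = create (H e) x)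
    (fun x y hx hy => by rw [map_add, map_add, map_add, hx, hy]) (fun n x => ?_) x
  rw [create_of, gauge, lift_of, create_of]
  simp

theorem inner_of_of (n : ℕ) (x y : TPow E n) :
    ⟪(of n x : AlgFock E), of n y⟫_ℂ = ⟪x, y⟫_ℂ := by
  rw [inner_def, finsum_eq_single _ n]
  · rw [component_of_self, component_of_self]
  · intro m hm
    rw [component_of_ne hm.symm, inner_zero_left]

theorem inner_of_of_ne {m n : ℕ} (h : m ≠ n) (x : TPow E m) (y : TPow E n) :
    ⟪(of m x : AlgFock E), of n y⟫_ℂ = 0 := by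
  rw [inner_def, finsum_eq_single _ m]
  · rw [component_of_ne h.symm, inner_zero_right]
  · intro k hk
    rw [component_of_ne hk.symm, inner_zero_left]

theorem inner_vacuum_vacuum : ⟪vacuum E, vacuum E⟫_ℂ = 1 := by
  rw [vacuum, inner_of_of, LinearIsometryEquiv.inner_map_map]
  simp

theorem norm_vacuum : ‖vacuum E‖ = 1 := by
  rw [norm_eq_sqrt_re_inner (𝕜 := ℂ), inner_vacuum_vacuum]
  simp

theorem inner_vacuum_create (e : E) (x : AlgFock E) : ⟪vacuum E, create e x⟫_ℂ = 0 := by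
  refine induction_of (p := fun x => ⟪vacuum E, create e x⟫_ℂ = 0)
    (fun x y hx hy => by rw [map_add, inner_add_right, hx, hy, add_zero]) (fun n x => ?_) x
  rw [create_of, vacuum]
  exact inner_of_of_ne (by omega) _ _

theorem inner_create_vacuum (e : E) (x : AlgFock E) : ⟪create e x, vacuum E⟫_ℂ = 0 := by
  rw [← inner_conj_symm, inner_vacuum_create, map_zero]

theorem inner_create_create (e f : E) (x y : AlgFock E) :
    ⟪create e x, create f y⟫_ℂ = ⟪e, f⟫_ℂ * ⟪x, y⟫_ℂ := by
  refine induction_of (p := fun x => ⟪create e x, create f y⟫_ℂ = ⟪e, f⟫_ℂ * ⟪x, y⟫_ℂ)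
    (fun x y hx hy => by rw [map_add, inner_add_left, inner_add_left, hx, hy, mul_add])
    (fun m x => ?_) x
  refine induction_of (p := fun y => ⟪create e (of m x), create f y⟫_ℂ = ⟪e, f⟫_ℂ * ⟪of m x, y⟫_ℂ)
    (fun x y hx hy => by rw [map_add, inner_add_right, inner_add_right, hx, hy, mul_add])
    (fun n y => ?_) y
  rw [create_of, create_of]
  by_cases h : m = n
  · subst h
    rw [inner_of_of, inner_of_of, LinearIsometryEquiv.inner_map_map, TensorProduct.inner_tmul]
  · rw [inner_of_of_ne h, inner_of_of_ne (by omega), mul_zero]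

theorem create_add (e f : E) (x : AlgFock E) : create (e + f) x = create e x + create f x := by
  refine induction_of (p := fun x => create (e + f) x = create e x + create f x)
    (fun x y hx hy => by rw [map_add, map_add, map_add, hx, hy]; abel) (fun n x => ?_) x
  rw [create_of, create_of, create_of, TensorProduct.add_tmul, map_add, map_add]

theorem inner_create_left (ζ : E) (x y : AlgFock E) :
    ⟪create ζ x, y⟫_ℂ = ⟪x, annihilate ζ y⟫_ℂ := by
  refine induction_create (p := fun y => ⟪create ζ x, y⟫_ℂ = ⟪x, annihilate ζ y⟫_ℂ) y
    (fun y z hy hz => by rw [map_add, inner_add_right, inner_add_right, hy, hz])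
    (fun c y hy => by rw [map_smul, inner_smul_right, inner_smul_right, hy]) ?_ (fun e y _ => ?_)
  · rw [annihilate_vacuum, inner_zero_right, inner_create_vacuum]
  · rw [annihilate_create, inner_create_create, inner_smul_right]

theorem gauge_isSymmetric {H : Module.End ℂ E} (hH : H.IsSymmetric) : (gauge H).IsSymmetric := by
  intro x y
  refine induction_create (p := fun x => ⟪gauge H x, y⟫_ℂ = ⟪x, gauge H y⟫_ℂ) x
    (fun y z hy hz => by rw [map_add, inner_add_left, inner_add_left, hy, hz])
    (fun c y hy => by rw [map_smul, inner_smul_left, inner_smul_left, hy]) ?_ (fun e x _ => ?_)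
  · rw [gauge_vacuum, inner_zero_left]
    refine induction_create (p := fun y => 0 = ⟪vacuum E, gauge H y⟫_ℂ) y
      (fun y z hy hz => by rw [map_add, inner_add_right, ← hy, ← hz, add_zero])
      (fun c y hy => by rw [map_smul, inner_smul_right, ← hy, mul_zero]) ?_ (fun f y _ => ?_)
    · rw [gauge_vacuum, inner_zero_right]
    · rw [gauge_create, inner_vacuum_create]
  · rw [gauge_create]
    refine induction_create
      (p := fun y => ⟪create (H e) x, y⟫_ℂ = ⟪create e x, gauge H y⟫_ℂ) y
      (fun y z hy hz => by rw [map_add, inner_add_right, inner_add_right, hy, hz])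
      (fun c y hy => by rw [map_smul, inner_smul_right, inner_smul_right, hy]) ?_ (fun f y _ => ?_)
    · rw [gauge_vacuum, inner_zero_right, inner_create_vacuum]
    · rw [gauge_create, inner_create_create, inner_create_create, hH e f]

theorem op_isSymmetric {d : ℕ} {ζ : Fin d → E} {H : Fin d → Module.End ℂ E}
    (hH : ∀ i, (H i).IsSymmetric) (lam : Fin d → ℝ) (i : Fin d) :
    (op ζ H lam i).IsSymmetric := by
  intro x y
  have h1 : ⟪annihilate (ζ i) x, y⟫_ℂ = ⟪x, create (ζ i) y⟫_ℂ := by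
    rw [← inner_conj_symm, ← inner_create_left, inner_conj_symm]
  simp only [op, LinearMap.add_apply, inner_add_left, inner_add_right, inner_create_left, h1,
    gauge_isSymmetric (hH i) x y, LinearMap.smul_apply, Module.End.one_apply, inner_smul_left,
    inner_smul_right, Complex.conj_ofReal]
  ring

theorem op_vacuum {d : ℕ} (ζ : Fin d → E) (H : Fin d → Module.End ℂ E) (lam : Fin d → ℝ)
    (i : Fin d) : op ζ H lam i (vacuum E) = create (ζ i) (vacuum E) + (lam i : ℂ) • vacuum E := by
  simp [op, annihilate_vacuum, gauge_vacuum]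

/-- The map `x₁ ⊗ ⋯ ⊗ x_n ↦ x₁ ⊗ ⋯ ⊗ x_n ⊗ k`. -/
def snoc (k : E) : (n : ℕ) → TPow E n →ₗ[ℂ] TPow E (n + 1)
  | 0 => (TPow.consEquiv E 0).toLinearEquiv.toLinearMap ∘ₗ TensorProduct.mk ℂ E (TPow E 0) k
  | n + 1 => (TPow.consEquiv E (n + 1)).toLinearEquiv.toLinearMap ∘ₗ (snoc k n).lTensor E ∘ₗ
      (TPow.consEquiv E n).symm.toLinearEquiv.toLinearMap

/-- The right creation operator `x₁ ⊗ ⋯ ⊗ x_n ↦ x₁ ⊗ ⋯ ⊗ x_n ⊗ k`. -/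
def rightCreate (k : E) : Module.End ℂ (AlgFock E) := lift fun n => of (n + 1) ∘ₗ snoc k n

theorem rightCreate_vacuum (k : E) : rightCreate k (vacuum E) = create k (vacuum E) := by
  rw [rightCreate, vacuum, lift_of, create_of]; rfl

/-- Creations at opposite ends of a tensor commute. They coincide only on the vacuum, the source of
the correction in `op_rightCreate`. -/
theorem rightCreate_create (k e : E) (x : AlgFock E) :
    rightCreate k (create e x) = create e (rightCreate k x) := by
  refine induction_of (p := fun x => rightCreate k (create e x) = create e (rightCreate k x))
    (fun x y hx hy => by simp only [map_add, hx, hy]) (fun n x => ?_) x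
  rw [create_of, rightCreate, lift_of, lift_of, LinearMap.comp_apply, LinearMap.comp_apply,
    create_of, snoc]
  simp

theorem inner_rightCreate_vacuum (k : E) (x : AlgFock E) :
    ⟪rightCreate k x, vacuum E⟫_ℂ = 0 := by
  refine induction_create (p := fun x => ⟪rightCreate k x, vacuum E⟫_ℂ = 0) x
    (fun y z hy hz => by rw [map_add, inner_add_left, hy, hz, add_zero])
    (fun c y hy => by rw [map_smul, inner_smul_left, hy, mul_zero]) ?_ (fun e x _ => ?_)
  · rw [rightCreate_vacuum, inner_create_vacuum]
  · rw [rightCreate_create, inner_create_vacuum]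

/-- Right creation operators commute with the left ones up to a correction at the vacuum. -/
theorem op_rightCreate {d : ℕ} (ζ : Fin d → E) (H : Fin d → Module.End ℂ E) (lam : Fin d → ℝ)
    (i : Fin d) (k : E) (x : AlgFock E) :
    op ζ H lam i (rightCreate k x) = rightCreate k (op ζ H lam i x) +
      ⟪vacuum E, x⟫_ℂ • (create (H i k) (vacuum E) + ⟪ζ i, k⟫_ℂ • vacuum E) := by
  refine induction_create (p := fun x => op ζ H lam i (rightCreate k x) =
      rightCreate k (op ζ H lam i x) +
      ⟪vacuum E, x⟫_ℂ • (create (H i k) (vacuum E) + ⟪ζ i, k⟫_ℂ • vacuum E)) x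
    (fun y z hy hz => by simp only [map_add, inner_add_right, hy, hz, add_smul]; abel)
    (fun c y hy => by simp only [map_smul, inner_smul_right, hy, smul_add, mul_smul]) ?_
    (fun e x _ => ?_)
  -- Only over the vacuum is the vector k, added on the right, also leftmost, so that the gauge and
  -- annihilation operators reach it.
  · rw [inner_vacuum_vacuum, op_vacuum]
    simp only [rightCreate_vacuum, op, LinearMap.add_apply, annihilate_create, gauge_create,
      map_add, map_smul, rightCreate_create, one_smul, LinearMap.smul_apply, Module.End.one_apply]
    abel
  · rw [inner_vacuum_create, zero_smul, add_zero]
    simp only [op, LinearMap.add_apply, annihilate_create, gauge_create, map_add, map_smul,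
      rightCreate_create, LinearMap.smul_apply, Module.End.one_apply]

theorem map_vacuum (J : E →ₗᵢ[ℂ] F) : map J (vacuum E) = vacuum F := by
  change lift (fun n => of n ∘ₗ (TPow.map J n).toLinearMap) (vacuum E) = vacuum F
  rw [vacuum, lift_of, vacuum, LinearMap.comp_apply]
  congr 1

theorem map_create (J : E →ₗᵢ[ℂ] F) (e : E) (x : AlgFock E) :
    map J (create e x) = create (J e) (map J x) := by
  change lift (fun n => of n ∘ₗ (TPow.map J n).toLinearMap) (create e x) =
    create (J e) (lift (fun n => of n ∘ₗ (TPow.map J n).toLinearMap) x)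
  refine induction_of (p := fun x => lift (fun n => of n ∘ₗ (TPow.map J n).toLinearMap)
      (create e x) = create (J e) (lift (fun n => of n ∘ₗ (TPow.map J n).toLinearMap) x))
    (fun x y hx hy => by simp only [map_add, hx, hy]) (fun n x => ?_) x
  rw [create_of, lift_of, lift_of, LinearMap.comp_apply, LinearMap.comp_apply]
  simp [create_of, TPow.map]

end AlgFock

end TwoState
end

noncomputable section

namespace TwoState

open NCSeries

variable {d : ℕ}

/-! ### Cumulants of the Fock space models -/

section Cumulants

variable {E F : Type*} [NormedAddCommGroup E] [InnerProductSpace ℂ E]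
  [NormedAddCommGroup F] [InnerProductSpace ℂ F]

theorem word_nil (X : Fin d → Module.End ℂ E) : word X [] = 1 := rfl

theorem word_cons (X : Fin d → Module.End ℂ E) (i : Fin d) (u : List (Fin d)) :
    word X (i :: u) = X i * word X u := by simp [word]

/-- The series with coefficients `⟨x, X_u y⟩`. -/
def matrixSeries (X : Fin d → Module.End ℂ E) (x y : E) : NCSeries d :=
  fun u => ⟪x, word X u y⟫_ℂ

theorem matrixSeries_nil (X : Fin d → Module.End ℂ E) (x y : E) :
    matrixSeries X x y [] = ⟪x, y⟫_ℂ := rfl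

/-- Symmetry moves the first letter onto the left vector, so left derivatives of a matrix series are
again matrix series with the same right vector. -/
theorem matrixSeries_cons {X : Fin d → Module.End ℂ E} (hX : ∀ i, (X i).IsSymmetric) (x y : E)
    (i : Fin d) (u : List (Fin d)) :
    matrixSeries X x y (i :: u) = matrixSeries X (X i x) y u := by
  rw [matrixSeries, word_cons, Module.End.mul_apply, ← hX i, matrixSeries]

theorem D_matrixSeries {X : Fin d → Module.End ℂ E} (hX : ∀ i, (X i).IsSymmetric) (x y : E)
    (i : Fin d) : D i (matrixSeries X x y) = matrixSeries X (X i x) y :=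
  funext fun u => matrixSeries_cons hX x y i u

theorem matrixSeries_add_left (X : Fin d → Module.End ℂ E) (x x' y : E) :
    matrixSeries X (x + x') y = matrixSeries X x y + matrixSeries X x' y :=
  funext fun _ => inner_add_left _ _ _

theorem matrixSeries_smul_left (X : Fin d → Module.End ℂ E) (c : ℂ) (x y : E) :
    matrixSeries X (c • x) y = conj c • matrixSeries X x y :=
  funext fun _ => inner_smul_left _ _ _

/-- The series `∑ ⟨k, H_u ζ_j⟩ z_u z_j`. -/
def vectorCumulants (ζ : Fin d → E) (H : Fin d → Module.End ℂ E) : E → NCSeries d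
  | _, [] => 0
  | k, j :: u => vectorCumulants ζ H (H j k) u + if u = [] then ⟪k, ζ j⟫_ℂ else 0

/-- The series with coefficients `λ_i` at `z_i` and `⟨ζ_i, H_u ζ_j⟩` at `z_i z_u z_j`. -/
def fockCumulants (ζ : Fin d → E) (H : Fin d → Module.End ℂ E) (lam : Fin d → ℝ) : NCSeries d :=
  cons fun i => vectorCumulants ζ H (ζ i) + (lam i : ℂ) • one

theorem vectorCumulants_nil (ζ : Fin d → E) (H : Fin d → Module.End ℂ E) (k : E) :
    vectorCumulants ζ H k [] = 0 := by rw [vectorCumulants]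

theorem D_vectorCumulants (ζ : Fin d → E) (H : Fin d → Module.End ℂ E) (k : E) (j : Fin d) :
    D j (vectorCumulants ζ H k) = vectorCumulants ζ H (H j k) + ⟪k, ζ j⟫_ℂ • one := by
  funext u
  rw [D, vectorCumulants]
  simp [one]

theorem vectorCumulants_add (ζ : Fin d → E) (H : Fin d → Module.End ℂ E) (k l : E) :
    vectorCumulants ζ H (k + l) = vectorCumulants ζ H k + vectorCumulants ζ H l := by
  funext u
  induction u generalizing k l with
  | nil => simp [vectorCumulants_nil]
  | cons j u ih =>
    simp only [Pi.add_apply, vectorCumulants, map_add, ih, inner_add_left]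
    split_ifs <;> ring

theorem vectorCumulants_smul (ζ : Fin d → E) (H : Fin d → Module.End ℂ E) (c : ℂ) (k : E) :
    vectorCumulants ζ H (c • k) = conj c • vectorCumulants ζ H k := by
  funext u
  induction u generalizing k with
  | nil => simp [vectorCumulants_nil]
  | cons j u ih =>
    simp only [Pi.smul_apply, vectorCumulants, map_smul, ih, inner_smul_left, smul_eq_mul]
    split_ifs <;> ring

theorem fockCumulants_nil (ζ : Fin d → E) (H : Fin d → Module.End ℂ E) (lam : Fin d → ℝ) :
    fockCumulants ζ H lam [] = 0 := rfl

theorem D_fockCumulants (ζ : Fin d → E) (H : Fin d → Module.End ℂ E) (lam : Fin d → ℝ)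
    (i : Fin d) :
    D i (fockCumulants ζ H lam) = vectorCumulants ζ H (ζ i) + (lam i : ℂ) • one := rfl

/-- Scaling the vectors by `√t` and the scalars by `t` multiplies the cumulants by `t`. -/
theorem fockCumulants_scale (ζ : Fin d → E) (H : Fin d → Module.End ℂ E) (lam : Fin d → ℝ)
    {t : ℝ} (ht : 0 ≤ t) :
    fockCumulants (fun i => (√t : ℂ) • ζ i) H (fun i => t * lam i) =
      (t : ℂ) • fockCumulants ζ H lam := by
  -- One factor √t comes from the final vector ζ_j; the initial vector ζ_i contributes the other,
  -- which is unaffected by conjugation because √t is real.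
  have h : ∀ k, vectorCumulants (fun i => (√t : ℂ) • ζ i) H k =
      (√t : ℂ) • vectorCumulants ζ H k := by
    intro k
    funext u
    induction u generalizing k with
    | nil => simp [vectorCumulants_nil]
    | cons j u ih =>
      simp only [Pi.smul_apply, vectorCumulants, ih, inner_smul_right, smul_eq_mul]
      split_ifs <;> ring
  have h2 : (√t : ℂ) * √t = t := by
    rw [← Complex.ofReal_mul, Real.mul_self_sqrt ht]
  rw [fockCumulants, fockCumulants, ← cons_smul]
  congr 1
  funext i
  rw [h, vectorCumulants_smul, smul_smul, Complex.conj_ofReal, h2, smul_add, smul_smul,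
    Complex.ofReal_mul]

/-! #### The Boolean model -/

namespace BooleanFock

theorem inner_eq (x y : BooleanFock E) :
    ⟪x, y⟫_ℂ = y.fst * conj x.fst + ⟪x.snd, y.snd⟫_ℂ := by
  rw [WithLp.prod_inner_apply]; rfl

theorem inner_vacuum_vacuum : ⟪vacuum E, vacuum E⟫_ℂ = 1 := by simp [vacuum]

theorem inner_of_vacuum (x : E) : ⟪of x, vacuum E⟫_ℂ = 0 := by simp [of, vacuum]

theorem norm_vacuum : ‖vacuum E‖ = 1 := by
  rw [norm_eq_sqrt_re_inner (𝕜 := ℂ), inner_vacuum_vacuum]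
  simp

theorem op_apply (ζ : Fin d → E) (S : Fin d → Module.End ℂ E) (α : Fin d → ℝ) (i : Fin d)
    (x : BooleanFock E) : op ζ S α i x =
      WithLp.toLp 2 (⟪ζ i, x.snd⟫_ℂ + α i * x.fst, x.fst • ζ i + S i x.snd) := by
  apply WithLp.ofLp_injective 2
  ext <;> simp [op, create, annihilate, extend, proj, ketBra, of, vacuum]

theorem op_vacuum (ζ : Fin d → E) (S : Fin d → Module.End ℂ E) (α : Fin d → ℝ) (i : Fin d) :
    op ζ S α i (vacuum E) = of (ζ i) + (α i : ℂ) • vacuum E := by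
  rw [op_apply]
  apply WithLp.ofLp_injective 2
  ext <;> simp [of, vacuum]

theorem op_of (ζ : Fin d → E) (S : Fin d → Module.End ℂ E) (α : Fin d → ℝ) (i : Fin d) (k : E) :
    op ζ S α i (of k) = of (S i k) + ⟪ζ i, k⟫_ℂ • vacuum E := by
  rw [op_apply]
  apply WithLp.ofLp_injective 2
  ext <;> simp [of, vacuum]

theorem op_isSymmetric {ζ : Fin d → E} {S : Fin d → Module.End ℂ E}
    (hS : ∀ i, (S i).IsSymmetric) (α : Fin d → ℝ) (i : Fin d) : (op ζ S α i).IsSymmetric := by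
  intro x y
  rw [op_apply, op_apply, inner_eq, inner_eq]
  simp only [WithLp.fst, WithLp.snd]
  simp only [inner_add_left, inner_add_right, map_add, map_mul, inner_smul_left, inner_smul_right,
    inner_conj_symm, Complex.conj_ofReal, hS i x.ofLp.2 y.ofLp.2]
  ring

variable {ζ : Fin d → E} {S : Fin d → Module.End ℂ E}

/-- Starting from k, the operators S act inside E until the first return to the vacuum, where the
vacuum series starts afresh. This splits the word in two and gives the product. -/
theorem matrixSeries_op_of (hS : ∀ i, (S i).IsSymmetric) (α : Fin d → ℝ) (k : E) :
    matrixSeries (op ζ S α) (of k) (vacuum E) =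
      mul (vectorCumulants ζ S k) (matrixSeries (op ζ S α) (vacuum E) (vacuum E)) := by
  funext u
  induction u generalizing k with
  | nil => rw [mul_nil, vectorCumulants_nil, MulZeroClass.zero_mul, matrixSeries_nil, inner_of_vacuum]
  | cons j u ih =>
    rw [matrixSeries_cons (op_isSymmetric hS α), op_of, matrixSeries_add_left,
      matrixSeries_smul_left, Pi.add_apply, ih, mul_apply_cons, vectorCumulants_nil,
      D_vectorCumulants, add_mul, smul_mul, one_mul]
    simp

/-- The Boolean cumulants of the model on the Boolean Fock space. -/
theorem matrixSeries_op_vacuum (hS : ∀ i, (S i).IsSymmetric) (α : Fin d → ℝ) :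
    matrixSeries (op ζ S α) (vacuum E) (vacuum E) = one + mul (fockCumulants ζ S α)
      (matrixSeries (op ζ S α) (vacuum E) (vacuum E)) := by
  conv_lhs => rw [eq_add_cons (matrixSeries (op ζ S α) (vacuum E) (vacuum E))]
  rw [matrixSeries_nil, inner_vacuum_vacuum, one_smul, fockCumulants, cons_mul]
  congr 2
  funext i
  rw [D_matrixSeries (op_isSymmetric hS α), op_vacuum, matrixSeries_add_left,
    matrixSeries_smul_left, matrixSeries_op_of hS, add_mul, smul_mul, one_mul,
    Complex.conj_ofReal]

end BooleanFock

/-- Matrix coefficients of operators `Y_i` which agree with `T_i` along the map `r`, up to a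
correction at the vector `Ω`. -/
theorem matrixSeries_eq_of_intertwine {T : Fin d → Module.End ℂ E} {Y : Fin d → Module.End ℂ F}
    (hT : ∀ i, (T i).IsSymmetric) (hY : ∀ i, (Y i).IsSymmetric) {Ω : E} (r : E → F)
    (s : Fin d → F) (hr : ∀ i x, Y i (r x) = r (T i x) + ⟪Ω, x⟫_ℂ • s i) {y : F} {β : ℂ}
    (hy : ∀ x, ⟪r x, y⟫_ℂ = β * ⟪x, Ω⟫_ℂ) (x : E) :
    matrixSeries Y (r x) y = β • matrixSeries T x Ω +
      mul (matrixSeries T x Ω) (cons fun j => matrixSeries Y (s j) y) := by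
  funext u
  induction u generalizing x with
  | nil => simp [matrixSeries_nil, mul_nil, cons, hy]
  | cons i u ih =>
    rw [matrixSeries_cons hY, hr, matrixSeries_add_left, matrixSeries_smul_left, Pi.add_apply, ih]
    simp only [Pi.add_apply, Pi.smul_apply, smul_eq_mul, cons, mul_apply_cons, D_matrixSeries hT,
      matrixSeries_cons hT, matrixSeries_nil, inner_conj_symm]
    ring

end Cumulants

/-! #### The free model -/

namespace AlgFock

variable {E : Type u} [NormedAddCommGroup E] [InnerProductSpace ℂ E]
  {ζ : Fin d → E} {H : Fin d → Module.End ℂ E}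

/-- Viewing k as created from the right over the vacuum, `op_rightCreate` gives the series the
recursion G_k = a Σ z_j (G_{H_j k} + ⟨k, ζ_j⟩ a). The product c_k(a z) a, with c_k the vector
cumulants, obeys the same recursion. There is no β-term because the range of right creation is
orthogonal to the vacuum. -/
theorem matrixSeries_op_create (hH : ∀ i, (H i).IsSymmetric) (lam : Fin d → ℝ) (k : E) :
    matrixSeries (op ζ H lam) (create k (vacuum E)) (vacuum E) =
      mul (subst (matrixSeries (op ζ H lam) (vacuum E) (vacuum E)) (vectorCumulants ζ H k))
        (matrixSeries (op ζ H lam) (vacuum E) (vacuum E)) := by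
  set a := matrixSeries (op ζ H lam) (vacuum E) (vacuum E) with ha
  have key := eq_of_recursion a
    (fun k => matrixSeries (op ζ H lam) (create k (vacuum E)) (vacuum E))
    (fun k => mul (subst a (vectorCumulants ζ H k)) a)
    (fun G k j => G (H j k) + ⟪k, ζ j⟫_ℂ • a) (fun _ => 0)
    (fun _ h _ _ _ hv => by simp [h _ _ hv]) (fun k => ?_) (fun k => ?_)
  · exact congrFun key k
  · have := matrixSeries_eq_of_intertwine (op_isSymmetric hH lam) (op_isSymmetric hH lam)
      (Ω := vacuum E) (fun x => rightCreate k x)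
      (fun i => create (H i k) (vacuum E) + ⟪ζ i, k⟫_ℂ • vacuum E)
      (fun i x => op_rightCreate ζ H lam i k x) (y := vacuum E) (β := 0)
      (fun x => by rw [inner_rightCreate_vacuum, MulZeroClass.zero_mul]) (vacuum E)
    rw [rightCreate_vacuum, zero_smul] at this
    simp only [matrixSeries_add_left, matrixSeries_smul_left, inner_conj_symm] at this
    exact this
  · simp only [zero_add]
    conv_lhs => rw [subst_eq, vectorCumulants_nil, zero_smul, zero_add, mul_assoc, cons_mul]
    simp only [D_vectorCumulants, subst_add, subst_smul, subst_one, add_mul, smul_mul, one_mul]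

/-- The free cumulants of the model on the full Fock space. -/
theorem matrixSeries_op_vacuum (hH : ∀ i, (H i).IsSymmetric) (lam : Fin d → ℝ) :
    matrixSeries (op ζ H lam) (vacuum E) (vacuum E) = one +
      subst (matrixSeries (op ζ H lam) (vacuum E) (vacuum E)) (fockCumulants ζ H lam) := by
  set a := matrixSeries (op ζ H lam) (vacuum E) (vacuum E) with ha
  have ha1 : a [] = 1 := by rw [ha, matrixSeries_nil, inner_vacuum_vacuum]
  set e : NCSeries d := cons fun i => subst a (D i (fockCumulants ζ H lam)) with he
  have h1 : a = one + mul e a := by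
    conv_lhs => rw [eq_add_cons a]
    rw [ha1, one_smul, he, cons_mul]
    congr 2
    funext i
    rw [ha, D_matrixSeries (op_isSymmetric hH lam), op_vacuum, matrixSeries_add_left,
      matrixSeries_smul_left, matrixSeries_op_create hH, D_fockCumulants, subst_add, subst_smul,
      subst_one, add_mul, smul_mul, one_mul, Complex.conj_ofReal]
  -- Left derivatives yield a = 1 + e a, whereas R(a z) = a e. The two orders agree because a left
  -- inverse of a is also its right inverse.
  have h2 : mul (one - e) a = one := by
    have : mul (one - e) a + mul e a = a := by rw [← add_mul, sub_add_cancel, one_mul]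
    rw [eq_sub_of_add_eq this, sub_eq_iff_eq_add]
    exact h1
  have h3 : mul a (one - e) = one := by
    rw [eq_inv_of_mul_eq_one ha1 h2, NCSeries.mul_inv _ ha1]
  rw [NCSeries.mul_sub, mul_one, sub_eq_iff_eq_add] at h3
  rw [subst_eq, fockCumulants_nil, zero_smul, zero_add]
  exact h3

end AlgFock

end TwoState
end

noncomputable section

namespace TwoState

open NCSeries

variable {d : ℕ}

/-! ### Symmetric operators, dense domains and representations -/

section Tensor

variable {E E' F F' : Type*} [NormedAddCommGroup E] [InnerProductSpace ℂ E]
  [NormedAddCommGroup E'] [InnerProductSpace ℂ E']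
  [NormedAddCommGroup F] [InnerProductSpace ℂ F] [NormedAddCommGroup F'] [InnerProductSpace ℂ F']

theorem proj_apply (v x : E) : proj v x = ⟪v, x⟫_ℂ • v := rfl

theorem proj_isSymmetric (v : E) : (proj v).IsSymmetric := by
  intro x y
  rw [proj_apply, proj_apply, inner_smul_left, inner_smul_right, inner_conj_symm, mul_comm]

theorem tensorMap_isSymmetric {S : Module.End ℂ E} {T : Module.End ℂ F} (hS : S.IsSymmetric)
    (hT : T.IsSymmetric) : (TensorProduct.map S T : Module.End ℂ (E ⊗[ℂ] F)).IsSymmetric := by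
  intro x y
  induction x with
  | zero => simp
  | add x x' hx hx' => rw [map_add, inner_add_left, inner_add_left, hx, hx']
  | tmul e f =>
    induction y with
    | zero => simp
    | add y y' hy hy' => rw [map_add, inner_add_right, inner_add_right, hy, hy']
    | tmul e' f' =>
      rw [TensorProduct.map_tmul, TensorProduct.map_tmul, TensorProduct.inner_tmul,
        TensorProduct.inner_tmul, hS e e', hT f f']

/-! ### Density of the algebraic domains -/

theorem denseRange_toComplₗᵢ_comp {J : E →ₗᵢ[ℂ] F} (h : DenseRange J) :
    DenseRange ((UniformSpace.Completion.toComplₗᵢ (𝕜 := ℂ) (E := F)).comp J) :=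
  UniformSpace.Completion.denseRange_coe.comp h (UniformSpace.Completion.continuous_coe F)

theorem denseRange_of_forall_mem {J : E →ₗᵢ[ℂ] F}
    (h : ∀ y, y ∈ (LinearMap.range J.toLinearMap).topologicalClosure) : DenseRange J :=
  fun y => h y

/-- The closure of the range is a subspace, so pure tensors suffice, and these are approximated by
continuity of the tensor product in both factors. -/
theorem HilbertTensor.denseRange_incl {J : E →ₗᵢ[ℂ] F} {J' : E' →ₗᵢ[ℂ] F'} (hJ : DenseRange J)
    (hJ' : DenseRange J') : DenseRange (HilbertTensor.incl J J') := by
  refine denseRange_toComplₗᵢ_comp (denseRange_of_forall_mem fun y => ?_)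
  induction y with
  | zero => exact Submodule.zero_mem _
  | add y y' hy hy' => exact Submodule.add_mem _ hy hy'
  | tmul f f' =>
    refine map_mem_closure₂ (f := fun f f' => f ⊗ₜ[ℂ] f') (by fun_prop) (hJ f) (hJ' f') ?_
    rintro _ ⟨e, rfl⟩ _ ⟨e', rfl⟩
    exact ⟨e ⊗ₜ e', by simp⟩

theorem BooleanFock.denseRange_incl {J : E →ₗᵢ[ℂ] F} (hJ : DenseRange J) :
    DenseRange (BooleanFock.incl J) := by
  intro y
  refine map_mem_closure (f := fun f => WithLp.toLp 2 (y.fst, f))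
    ((WithLp.prod_continuous_toLp 2 ℂ F).comp (by fun_prop)) (hJ y.snd) ?_
  rintro _ ⟨e, rfl⟩
  exact ⟨WithLp.toLp 2 (y.fst, e), rfl⟩

end Tensor

theorem AlgFock.norm_create {E : Type u} [NormedAddCommGroup E] [InnerProductSpace ℂ E] (e : E)
    (x : AlgFock E) : ‖AlgFock.create e x‖ = ‖e‖ * ‖x‖ := by
  rw [← sq_eq_sq₀ (norm_nonneg _) (by positivity), mul_pow]
  have h := AlgFock.inner_create_create e e x x
  simp only [inner_self_eq_norm_sq_to_K] at h
  exact_mod_cast h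

theorem FullFock.denseRange_incl {E : Type u} [NormedAddCommGroup E] [InnerProductSpace ℂ E]
    {F : Type v} [NormedAddCommGroup F] [InnerProductSpace ℂ F] {J : E →ₗᵢ[ℂ] F}
    (hJ : DenseRange J) : DenseRange (FullFock.incl J) := by
  refine denseRange_toComplₗᵢ_comp (denseRange_of_forall_mem fun y => ?_)
  refine AlgFock.induction_create y (fun x y hx hy => Submodule.add_mem _ hx hy)
    (fun c x hx => Submodule.smul_mem _ c hx)
    (Submodule.le_topologicalClosure _ ⟨AlgFock.vacuum E, AlgFock.map_vacuum J⟩) fun f x hx => ?_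
  -- By ‖create e x‖ = ‖e‖ ‖x‖, creation is continuous in each variable separately. First x is
  -- approximated with e in the range of J, then e; the resulting double closure collapses.
  have h1 : ∀ e : F, Continuous (AlgFock.create e) := fun e =>
    AddMonoidHomClass.continuous_of_bound (AlgFock.create e) ‖e‖ fun x =>
      (AlgFock.norm_create e x).le
  have h2 : Continuous fun e : F => AlgFock.create e x :=
    AddMonoidHomClass.continuous_of_bound
      (AddMonoidHom.mk' (fun e : F => AlgFock.create e x) fun e f => AlgFock.create_add e f x) ‖x‖
      fun e => by rw [mul_comm]; exact (AlgFock.norm_create e x).le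
  have h3 : ∀ e : E, AlgFock.create (J e) x ∈
      closure (LinearMap.range (AlgFock.map J).toLinearMap : Set (AlgFock F)) := by
    intro e
    refine map_mem_closure (h1 (J e)) hx ?_
    rintro _ ⟨z, rfl⟩
    exact ⟨AlgFock.create e z, AlgFock.map_create J e z⟩
  have h4 := map_mem_closure h2 (hJ f) (t := closure
    (LinearMap.range (AlgFock.map J).toLinearMap : Set (AlgFock F))) (by
      rintro _ ⟨e, rfl⟩
      exact h3 e)
  rwa [closure_closure] at h4

/-- Both series are right inverses of 1 - η, which is invertible since η has no constant term. -/
theorem NCSeries.eq_of_eq_one_add_mul {η m m' : NCSeries d} (hη : η [] = 0)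
    (hm : m = one + mul η m) (hm' : m' = one + mul η m') : m = m' := by
  have key : ∀ m, m = one + mul η m → mul (one - η) m = one := by
    intro m hm
    have : mul (one - η) m + mul η m = m := by rw [← add_mul, sub_add_cancel, one_mul]
    rw [eq_sub_of_add_eq this, sub_eq_iff_eq_add]
    exact hm
  exact mul_left_cancel (f := one - η) (by simp [one, hη]) ((key m hm).trans (key m' hm').symm)

/-! ### Representations and Boolean cumulants -/

section Represent

variable {E 𝓗 : Type*} [NormedAddCommGroup E] [InnerProductSpace ℂ E] [NormedAddCommGroup 𝓗]
  [InnerProductSpace ℂ 𝓗]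

theorem IsRepresentedOn.moment_eq_matrixSeries {φ : Functional d} {J : E →ₗᵢ[ℂ] 𝓗}
    {X : Fin d → Module.End ℂ E} {v : E} (h : IsRepresentedOn φ J X v) :
    moment φ = matrixSeries X v v := by
  funext u
  rw [h.moment_eq, LinearIsometry.inner_map_map, matrixSeries]

theorem IsRepresentedOn.of_moment_eq {φ : Functional d} {J : E →ₗᵢ[ℂ] 𝓗}
    {X : Fin d → Module.End ℂ E} {v : E} (hJ : DenseRange J) (hX : ∀ i, (X i).IsSymmetric)
    (hv : ‖v‖ = 1) (h : moment φ = matrixSeries X v v) : IsRepresentedOn φ J X v :=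
  ⟨hJ, hX, hv, fun u => by rw [h, LinearIsometry.inner_map_map, matrixSeries]⟩

theorem IsRepresentedOn.map_one {φ : Functional d} {J : E →ₗᵢ[ℂ] 𝓗}
    {X : Fin d → Module.End ℂ E} {v : E} (h : IsRepresentedOn φ J X v) : φ 1 = 1 := by
  rw [← moment_nil, h.moment_eq_matrixSeries, matrixSeries_nil, inner_self_eq_norm_sq_to_K,
    h.norm_eq_one]
  simp

variable {ζ : Fin d → E} {S : Fin d → Module.End ℂ E} {α : Fin d → ℝ}

theorem isRepresentedOn_booleanFock {J : E →ₗᵢ[ℂ] 𝓗} {φ : Functional d} (hJ : DenseRange J)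
    (hS : ∀ i, (S i).IsSymmetric) (h1 : φ 1 = 1) (h : booleanCumulants φ = fockCumulants ζ S α) :
    IsRepresentedOn φ (BooleanFock.incl J) (BooleanFock.op ζ S α) (BooleanFock.vacuum E) := by
  refine .of_moment_eq (BooleanFock.denseRange_incl hJ) (BooleanFock.op_isSymmetric hS α)
    BooleanFock.norm_vacuum ?_
  have hm := moment_eq_mul_booleanCumulants h1
  rw [h] at hm
  exact eq_of_eq_one_add_mul (fockCumulants_nil ζ S α) hm (BooleanFock.matrixSeries_op_vacuum hS α)

theorem booleanCumulants_eq_fockCumulants {φ : Functional d} (hS : ∀ i, (S i).IsSymmetric)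
    (h : moment φ = matrixSeries (BooleanFock.op ζ S α) (BooleanFock.vacuum E)
      (BooleanFock.vacuum E)) : booleanCumulants φ = fockCumulants ζ S α := by
  refine booleanCumulants_eq ?_ ?_
  · rw [← moment_nil, h, matrixSeries_nil, BooleanFock.inner_vacuum_vacuum]
  · rw [h]
    exact BooleanFock.matrixSeries_op_vacuum hS α

end Represent

/-! ### Representations and free cumulants -/

section FreeRepresent

variable {E : Type u} [NormedAddCommGroup E] [InnerProductSpace ℂ E]
  {F : Type v} [NormedAddCommGroup F] [InnerProductSpace ℂ F]
  {ζ : Fin d → E} {H : Fin d → Module.End ℂ E} {lam : Fin d → ℝ}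

/-- The moments and the vacuum series of the model solve the same equation m = 1 + R(m z). -/
theorem moment_eq_matrixSeries_fullFock {φ : Functional d} (hH : ∀ i, (H i).IsSymmetric)
    (h1 : φ 1 = 1) (h : freeCumulants φ = fockCumulants ζ H lam) :
    moment φ = matrixSeries (AlgFock.op ζ H lam) (AlgFock.vacuum E) (AlgFock.vacuum E) := by
  have hm := moment_eq_subst_freeCumulants h1
  rw [h] at hm
  rw [eq_moment_ofFreeCumulants (fockCumulants_nil ζ H lam) hm]
  exact (eq_moment_ofFreeCumulants (fockCumulants_nil ζ H lam)
    (AlgFock.matrixSeries_op_vacuum hH lam)).symm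

theorem isRepresentedOn_fullFock {J : E →ₗᵢ[ℂ] F} {φ : Functional d} (hJ : DenseRange J)
    (hH : ∀ i, (H i).IsSymmetric) (h1 : φ 1 = 1)
    (h : freeCumulants φ = fockCumulants ζ H lam) :
    IsRepresentedOn φ (FullFock.incl J) (AlgFock.op ζ H lam) (AlgFock.vacuum E) :=
  .of_moment_eq (FullFock.denseRange_incl hJ) (AlgFock.op_isSymmetric hH lam) AlgFock.norm_vacuum
    (moment_eq_matrixSeries_fullFock hH h1 h)

theorem freeCumulants_eq_fockCumulants {φ : Functional d} (hH : ∀ i, (H i).IsSymmetric)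
    (h : moment φ = matrixSeries (AlgFock.op ζ H lam) (AlgFock.vacuum E) (AlgFock.vacuum E)) :
    freeCumulants φ = fockCumulants ζ H lam := by
  refine freeCumulants_eq ?_ (fockCumulants_nil ζ H lam) ?_
  · rw [← moment_nil, h, matrixSeries_nil, AlgFock.inner_vacuum_vacuum]
  · rw [h]
    exact AlgFock.matrixSeries_op_vacuum hH lam

end FreeRepresent

/-! ### The models over the tensor product -/

section TensorModel

variable {E : Type u} [NormedAddCommGroup E] [InnerProductSpace ℂ E]
  {F : Type v} [NormedAddCommGroup F] [InnerProductSpace ℂ F]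
  {K : Fin d → Module.End ℂ E} {ξ : E} {ζ : Fin d → F} {H : Fin d → Module.End ℂ F}

/-- K_j only moves κ, while P_ξ ⊗ H_j resets κ to ξ with factor ⟨ξ, κ⟩ and moves k. So between two
successive actions on the ℋ-factor a series of moments of K is inserted, which is the substitution z
↦ m z. -/
theorem vectorCumulants_tensor (hK : ∀ i, (K i).IsSymmetric) (κ : E) (k : F) :
    vectorCumulants (fun i => ξ ⊗ₜ[ℂ] ζ i)
        (fun i => TensorProduct.map (K i) LinearMap.id + TensorProduct.map (proj ξ) (H i))
        (κ ⊗ₜ[ℂ] k) =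
      mul (matrixSeries K κ ξ)
        (cons fun j => subst (matrixSeries K ξ ξ) (D j (vectorCumulants ζ H k))) := by
  funext u
  induction u generalizing κ k with
  | nil => simp [vectorCumulants_nil, mul_nil, cons]
  | cons j u ih =>
    -- For κ = ξ the claimed formula collapses to c_k(m z), with c_k the vector cumulants; this is
    -- what remains after a reset to ξ.
    have hs : ∀ k, mul (matrixSeries K ξ ξ) (cons fun j => subst (matrixSeries K ξ ξ)
        (D j (vectorCumulants ζ H k))) = subst (matrixSeries K ξ ξ) (vectorCumulants ζ H k) := by
      intro k
      conv_rhs => rw [subst_eq, vectorCumulants_nil, zero_smul, zero_add]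
    rw [vectorCumulants, LinearMap.add_apply, TensorProduct.map_tmul, TensorProduct.map_tmul,
      proj_apply, LinearMap.id_apply, ← TensorProduct.smul_tmul', vectorCumulants_add,
      vectorCumulants_smul, Pi.add_apply, Pi.smul_apply, ih, ih, hs, mul_apply_cons,
      matrixSeries_nil, D_matrixSeries hK, inner_conj_symm, TensorProduct.inner_tmul]
    simp only [cons, D_vectorCumulants, subst_add, subst_smul, subst_one, Pi.add_apply,
      Pi.smul_apply, smul_eq_mul, one]
    split_ifs <;> ring

theorem fockCumulants_tensor (hK : ∀ i, (K i).IsSymmetric) (lam : Fin d → ℝ) :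
    fockCumulants (fun i => ξ ⊗ₜ[ℂ] ζ i)
        (fun i => TensorProduct.map (K i) LinearMap.id + TensorProduct.map (proj ξ) (H i)) lam =
      cons fun i => subst (matrixSeries K ξ ξ) (D i (fockCumulants ζ H lam)) := by
  rw [fockCumulants]
  congr 1
  funext i
  rw [vectorCumulants_tensor hK, D_fockCumulants, subst_add, subst_smul, subst_one,
    subst_eq _ (vectorCumulants ζ H (ζ i)), vectorCumulants_nil, zero_smul, zero_add]

theorem tensorOp_isSymmetric (hK : ∀ i, (K i).IsSymmetric) (hH : ∀ i, (H i).IsSymmetric)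
    (i : Fin d) : (TensorProduct.map (K i) LinearMap.id + TensorProduct.map (proj ξ) (H i) :
      Module.End ℂ (E ⊗[ℂ] F)).IsSymmetric :=
  (tensorMap_isSymmetric (hK i) LinearMap.IsSymmetric.id).add
    (tensorMap_isSymmetric (proj_isSymmetric ξ) (hH i))

/-- Matrix coefficients of `T_i ⊗ I + P_Ω ⊗ K_i`. -/
theorem matrixSeries_tensor_vacuum {T : Fin d → Module.End ℂ F} {Ω : F}
    (hT : ∀ i, (T i).IsSymmetric) (hK : ∀ i, (K i).IsSymmetric) (κ : E) :
    matrixSeries (fun i => TensorProduct.map (T i) LinearMap.id +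
        TensorProduct.map (proj Ω) (K i)) (Ω ⊗ₜ[ℂ] κ) (Ω ⊗ₜ[ℂ] ξ) =
      mul (subst (matrixSeries T Ω Ω) (matrixSeries K κ ξ)) (matrixSeries T Ω Ω) := by
  set Y : Fin d → Module.End ℂ (F ⊗[ℂ] E) := fun i => TensorProduct.map (T i) LinearMap.id +
        TensorProduct.map (proj Ω) (K i) with hYdef
  set b := matrixSeries T Ω Ω with hb
  have hY : ∀ i, (Y i).IsSymmetric := fun i =>
    (tensorMap_isSymmetric (hT i) LinearMap.IsSymmetric.id).add
      (tensorMap_isSymmetric (proj_isSymmetric Ω) (hK i))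
  have key := eq_of_recursion b (fun κ => matrixSeries Y (Ω ⊗ₜ[ℂ] κ) (Ω ⊗ₜ[ℂ] ξ))
    (fun κ => mul (subst b (matrixSeries K κ ξ)) b)
    (fun G κ j => G (K j κ)) (fun κ => ⟪κ, ξ⟫_ℂ • b) (fun _ h _ _ _ hv => h _ _ hv)
    (fun κ => ?_) (fun κ => ?_)
  · exact congrFun key κ
  -- Tensoring with κ intertwines T and Y except at Ω, where K_j acts on κ. This gives G_κ = ⟨κ, ξ⟩
  -- b + b Σ z_j G_{K_j κ}, the recursion also satisfied by the series of ⟨κ, K_u ξ⟩ evaluated at b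
  -- z and multiplied by b.
  · refine matrixSeries_eq_of_intertwine hT hY (Ω := Ω) (fun x => x ⊗ₜ[ℂ] κ)
      (fun j => Ω ⊗ₜ[ℂ] K j κ) (fun i x => ?_) (fun x => ?_) Ω
    · simp only [hYdef, LinearMap.add_apply, TensorProduct.map_tmul, proj_apply,
        LinearMap.id_apply, TensorProduct.smul_tmul']
    · rw [TensorProduct.inner_tmul, mul_comm]
  · conv_lhs => rw [subst_eq, add_mul, smul_mul, one_mul, mul_assoc, cons_mul]
    simp only [D_matrixSeries hK, matrixSeries_nil]

end TensorModel

end TwoState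
end

noncomputable section

namespace TwoState

open NCSeries

variable {d : ℕ}

/-! ### The involution -/

theorem adj_single (u : FreeMonoid (Fin d)) (c : ℂ) :
    adj (MonoidAlgebra.single u c) =
      MonoidAlgebra.single (FreeMonoid.ofList u.toList.reverse) (conj c) := by
  simp [adj]

theorem adj_add (P Q : NCPoly d) : adj (P + Q) = adj P + adj Q := by
  rw [adj, MonoidAlgebra.coeff_add, Finsupp.sum_add_index']
  · rfl
  · simp
  · simp

theorem adj_zero : adj (0 : NCPoly d) = 0 := by simp [adj]

theorem adj_one : adj (1 : NCPoly d) = 1 := by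
  rw [MonoidAlgebra.one_def, adj_single]; simp

theorem adj_smul (c : ℂ) (P : NCPoly d) : adj (c • P) = conj c • adj P := by
  induction P using MonoidAlgebra.induction_linear with
  | zero => simp [adj_zero]
  | add P Q hP hQ => rw [smul_add, adj_add, hP, hQ, adj_add, smul_add]
  | single u a => simp [adj_single]

theorem adj_mul (P Q : NCPoly d) : adj (P * Q) = adj Q * adj P := by
  induction P using MonoidAlgebra.induction_linear with
  | zero => simp [adj_zero]
  | add P P' hP hP' => rw [_root_.add_mul, adj_add, hP, hP', adj_add, _root_.mul_add]
  | single u a =>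
    induction Q using MonoidAlgebra.induction_linear with
    | zero => simp [adj_zero]
    | add P P' hP hP' => rw [_root_.mul_add, adj_add, hP, hP', adj_add, _root_.add_mul]
    | single v b =>
      simp only [adj_single, MonoidAlgebra.single_mul_single, FreeMonoid.toList_mul,
        List.reverse_append, FreeMonoid.ofList_append, map_mul, mul_comm]

theorem adj_adj (P : NCPoly d) : adj (adj P) = P := by
  induction P using MonoidAlgebra.induction_linear with
  | zero => simp [adj_zero]
  | add P Q hP hQ => rw [adj_add, adj_add, hP, hQ]
  | single u a => simp [adj_single]

theorem adj_sub (P Q : NCPoly d) : adj (P - Q) = adj P - adj Q := by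
  rw [eq_sub_iff_add_eq, ← adj_add, sub_add_cancel]

theorem monomial_nil : monomial ([] : List (Fin d)) = 1 := rfl

theorem monomial_append (u v : List (Fin d)) : monomial (u ++ v) = monomial u * monomial v := by
  simp [monomial, MonoidAlgebra.single_mul_single]

theorem monomial_cons (i : Fin d) (u : List (Fin d)) :
    monomial (i :: u) = monomial [i] * monomial u := monomial_append [i] u

theorem adj_monomial (u : List (Fin d)) : adj (monomial u) = monomial u.reverse := by
  simp [monomial, adj_single]

theorem single_eq_smul_monomial (u : FreeMonoid (Fin d)) (c : ℂ) :
    (MonoidAlgebra.single u c : NCPoly d) = c • monomial u.toList := by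
  simp [monomial]

/-! ### Represented functionals are states -/

section States

variable {E 𝓗 : Type*} [NormedAddCommGroup E] [InnerProductSpace ℂ E] [NormedAddCommGroup 𝓗]
  [InnerProductSpace ℂ 𝓗]

theorem inner_word_left {X : Fin d → Module.End ℂ E} (hX : ∀ i, (X i).IsSymmetric)
    (u : List (Fin d)) (x y : E) : ⟪word X u x, y⟫_ℂ = ⟪x, word X u.reverse y⟫_ℂ := by
  induction u generalizing x y with
  | nil => rfl
  | cons i u ih =>
    rw [word_cons, Module.End.mul_apply, hX i, ih, List.reverse_cons, word, word, List.map_append,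
      List.prod_append, Module.End.mul_apply]
    simp

/-- The vector `P(X) v`. -/
def polyVec (X : Fin d → Module.End ℂ E) (v : E) : NCPoly d →ₗ[ℂ] E :=
  Finsupp.linearCombination ℂ (fun u : FreeMonoid (Fin d) => word X u.toList v) ∘ₗ
    (MonoidAlgebra.coeffLinearEquiv ℂ).toLinearMap

theorem polyVec_single (X : Fin d → Module.End ℂ E) (v : E) (u : FreeMonoid (Fin d)) (c : ℂ) :
    polyVec X v (MonoidAlgebra.single u c) = c • word X u.toList v := by
  simp [polyVec]

/-- By symmetry of the operators, the form of φ is the inner product of the vectors P(X) v;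
positivity of represented functionals follows. -/
theorem IsRepresentedOn.apply_adj_mul {φ : Functional d} {J : E →ₗᵢ[ℂ] 𝓗}
    {X : Fin d → Module.End ℂ E} {v : E} (h : IsRepresentedOn φ J X v) (P Q : NCPoly d) :
    φ (adj P * Q) = ⟪polyVec X v P, polyVec X v Q⟫_ℂ := by
  induction P using MonoidAlgebra.induction_linear with
  | zero => simp [adj_zero]
  | add P P' hP hP' => rw [adj_add, _root_.add_mul, map_add, map_add, inner_add_left, hP, hP']
  | single u a =>
    induction Q using MonoidAlgebra.induction_linear with
    | zero => simp
    | add P P' hP hP' => rw [_root_.mul_add, map_add, map_add, inner_add_right, hP, hP']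
    | single w b =>
      have hm := congrFun h.moment_eq_matrixSeries (u.toList.reverse ++ w.toList)
      rw [moment, matrixSeries, monomial_append, word, List.map_append, List.prod_append,
        Module.End.mul_apply] at hm
      rw [polyVec_single, polyVec_single, inner_smul_left, inner_smul_right,
        inner_word_left h.isSymmetric, word, word, ← hm, single_eq_smul_monomial,
        single_eq_smul_monomial, adj_smul, adj_monomial, smul_mul_smul_comm, map_smul,
        smul_eq_mul]
      ring

theorem IsRepresentedOn.isState {φ : Functional d} {J : E →ₗᵢ[ℂ] 𝓗}
    {X : Fin d → Module.End ℂ E} {v : E} (h : IsRepresentedOn φ J X v) : IsState φ where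
  map_one := h.map_one
  map_adj P := by
    have h1 := h.apply_adj_mul P 1
    have h2 := h.apply_adj_mul 1 P
    rw [_root_.mul_one] at h1
    rw [adj_one, _root_.one_mul] at h2
    rw [h1, h2, inner_conj_symm]
  nonneg P := by
    rw [h.apply_adj_mul]
    exact inner_self_nonneg (𝕜 := ℂ)

end States

/-! ### Hilbert spaces from positive semidefinite forms -/

/-- A positive semidefinite form on `V` and symmetric operators on `V` induce a Hilbert space with
symmetric operators on a dense domain, which is a quotient of `V`. -/
theorem exists_hilbert_of_core {V : Type} [AddCommGroup V] [Module ℂ V]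
    (c : PreInnerProductSpace.Core ℂ V) {ι : Type*} (s : ι → Module.End ℂ V)
    (hs : ∀ i x y, c.inner (s i x) y = c.inner x (s i y)) :
    ∃ (𝓗 : Type) (_ : NormedAddCommGroup 𝓗) (_ : InnerProductSpace ℂ 𝓗) (_ : CompleteSpace 𝓗)
      (dom : Submodule ℂ 𝓗) (q : V →ₗ[ℂ] dom) (S : ι → Module.End ℂ dom),
      Dense (dom : Set 𝓗) ∧ (∀ i, (S i).IsSymmetric) ∧ (∀ i x, S i (q x) = q (s i x)) ∧
      ∀ x y, ⟪q x, q y⟫_ℂ = c.inner x y := by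
  let _ : SeminormedAddCommGroup V := InnerProductSpace.Core.toSeminormedAddCommGroup (c := c)
  let _ : InnerProductSpace ℂ V := InnerProductSpace.ofCore c
  let q₀ : V →ₗ[ℂ] UniformSpace.Completion V :=
    (UniformSpace.Completion.toComplₗᵢ (𝕜 := ℂ) (E := V)).toLinearMap
  let q : V →ₗ[ℂ] LinearMap.range q₀ := q₀.rangeRestrict
  have hq : ∀ x y, ⟪q x, q y⟫_ℂ = c.inner x y := fun x y =>
    UniformSpace.Completion.inner_coe x y
  have hsurj : Function.Surjective q := q₀.surjective_rangeRestrict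
  -- A linear section of q makes the induced operators definable as compositions, with no
  -- boundedness needed.
  obtain ⟨g, hg⟩ := q.exists_rightInverse_of_surjective (LinearMap.range_eq_top.mpr hsurj)
  have hg' : ∀ y, q (g y) = y := fun y => LinearMap.congr_fun hg y
  -- The choice of section is immaterial: if q z = 0, then ⟨s z, s z⟩ = ⟨z, s (s z)⟩ = 0, so
  -- symmetric operators preserve the null space.
  have hS : ∀ i x, (q ∘ₗ s i ∘ₗ g) (q x) = q (s i x) := by
    intro i x
    rw [← sub_eq_zero, ← inner_self_eq_zero (𝕜 := ℂ)]
    simp only [LinearMap.comp_apply]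
    rw [← map_sub, ← map_sub, hq, hs, ← hq, map_sub q (g (q x)) x, hg', sub_self,
      inner_zero_left]
  refine ⟨UniformSpace.Completion V, inferInstance, inferInstance, inferInstance,
    LinearMap.range q₀, q, fun i => q ∘ₗ s i ∘ₗ g, ?_, fun i x y => ?_, hS, hq⟩
  · have := UniformSpace.Completion.denseRange_coe (α := V)
    exact this
  · obtain ⟨x, rfl⟩ := hsurj x
    obtain ⟨y, rfl⟩ := hsurj y
    rw [hS, hS, hq, hq, hs]

/-- The form `⟨P, Q⟩ = L[(π P)^* (π Q)]`. -/
abbrev formCore (L : Functional d) (π : Module.End ℂ (NCPoly d))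
    (hL : ∀ P, L (adj P) = conj (L P)) (hpos : ∀ P, 0 ≤ (L (adj (π P) * π P)).re) :
    PreInnerProductSpace.Core ℂ (NCPoly d) where
  inner P Q := L (adj (π P) * π Q)
  conj_inner_symm P Q := by
    rw [← hL, adj_mul, adj_adj]
  re_inner_nonneg P := hpos P
  add_left P Q R := by rw [map_add, adj_add, _root_.add_mul, map_add]
  smul_left P Q c := by rw [map_smul, adj_smul, smul_mul_assoc, map_smul, smul_eq_mul]

/-- Left multiplication by `x_i`. -/
def mulVar (i : Fin d) : Module.End ℂ (NCPoly d) := LinearMap.mulLeft ℂ (monomial [i])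

theorem mulVar_apply (i : Fin d) (P : NCPoly d) : mulVar i P = monomial [i] * P := rfl

theorem adj_mulVar_mul (i : Fin d) (P Q : NCPoly d) :
    adj (mulVar i P) * Q = adj P * mulVar i Q := by
  rw [mulVar_apply, mulVar_apply, adj_mul, adj_monomial, List.reverse_singleton, _root_.mul_assoc]

theorem exists_vectorData {ψ : Functional d} (hψ : IsState ψ) :
    ∃ (𝒦 : Type) (_ : NormedAddCommGroup 𝒦) (_ : InnerProductSpace ℂ 𝒦)
      (_ : CompleteSpace 𝒦) (A : VectorData d 𝒦), A.Represents ψ := by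
  obtain ⟨𝒦, i₁, i₂, i₃, dom, q, S, hdense, hsymm, hS, hq⟩ := exists_hilbert_of_core
    (formCore ψ LinearMap.id hψ.map_adj hψ.nonneg) mulVar
    (fun i P Q => congrArg ψ (adj_mulVar_mul i P Q))
  have hinner : ∀ P Q, ⟪q P, q Q⟫_ℂ = ψ (adj P * Q) := hq
  have hnorm : ‖q 1‖ = 1 := by
    rw [norm_eq_sqrt_re_inner (𝕜 := ℂ), hinner, adj_one, _root_.one_mul, hψ.map_one]
    simp
  refine ⟨𝒦, i₁, i₂, i₃, ⟨dom, hdense, q 1, hnorm, S, hsymm⟩, ?_⟩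
  have hw : ∀ u, word S u (q 1) = q (monomial u) := by
    intro u
    induction u with
    | nil => rfl
    | cons i u ih => rw [word_cons, Module.End.mul_apply, ih, hS, mulVar_apply, ← monomial_cons]
  refine .of_moment_eq (by simpa [DenseRange] using hdense) hsymm hnorm (funext fun u => ?_)
  rw [matrixSeries, hw, hinner, adj_one, _root_.one_mul, moment]

/-- The map `P ↦ P - χ(P) 1`. -/
def centering (χ : Functional d) : Module.End ℂ (NCPoly d) := LinearMap.id - χ.smulRight 1

theorem centering_apply (χ : Functional d) (P : NCPoly d) : centering χ P = P - χ P • 1 := rfl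

theorem exists_booleanData {φ : Functional d} (hφ : IsState φ) :
    ∃ (𝒦 : Type) (_ : NormedAddCommGroup 𝒦) (_ : InnerProductSpace ℂ 𝒦)
      (_ : CompleteSpace 𝒦) (C : FockData d 𝒦), C.BooleanRepresents φ := by
  set π := centering φ with hπ
  have hφπ : ∀ P, φ (π P) = 0 := fun P => by
    rw [hπ, centering_apply, map_sub, map_smul, hφ.map_one, smul_eq_mul, _root_.mul_one, sub_self]
  have hππ : ∀ P, π (π P) = π P := fun P => by
    conv_lhs => rw [hπ, centering_apply, ← hπ, hφπ, zero_smul, sub_zero]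
  -- Centred polynomials are orthogonal to 1, so one of the two centrings may be dropped; this makes
  -- the compressed multiplications symmetric.
  have hleft : ∀ P Q, φ (adj P * π Q) = φ (adj (π P) * π Q) := fun P Q => by
    conv_rhs => rw [hπ, centering_apply φ P, ← hπ]
    rw [adj_sub, adj_smul, adj_one, _root_.sub_mul, map_sub, smul_mul_assoc, _root_.one_mul,
      map_smul, hφπ, smul_zero, sub_zero]
  have hright : ∀ P Q, φ (adj (π P) * Q) = φ (adj (π P) * π Q) := fun P Q => by
    conv_rhs => rw [hπ, centering_apply φ Q, ← hπ]
    rw [_root_.mul_sub, map_sub, mul_smul_comm, _root_.mul_one, map_smul, hφ.map_adj, hφπ,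
      map_zero, smul_zero, sub_zero]
  obtain ⟨𝒦, i₁, i₂, i₃, dom, q, S, hdense, hsymm, hS, hq⟩ := exists_hilbert_of_core
    (formCore φ π hφ.map_adj fun P => hφ.nonneg _) (fun i => mulVar i ∘ₗ π)
    (fun i P Q => by
      change φ (adj (π (mulVar i (π P))) * π Q) = φ (adj (π P) * π (mulVar i (π Q)))
      rw [← hleft, ← hright, adj_mulVar_mul])
  have hinner : ∀ P Q, ⟪q P, q Q⟫_ℂ = φ (adj (π P) * π Q) := hq
  have hqπ : ∀ P, q (π P) = q P := fun P => by
    rw [← sub_eq_zero, ← map_sub, ← inner_self_eq_zero (𝕜 := ℂ), hinner, map_sub, hππ, sub_self,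
      MulZeroClass.mul_zero, map_zero]
  have hq1 : q 1 = 0 := by
    rw [← hqπ, hπ, centering_apply, hφ.map_one, one_smul, sub_self, map_zero]
  have hreal : ∀ i, ((moment φ [i]).re : ℂ) = moment φ [i] := fun i => by
    rw [← Complex.conj_eq_iff_re, moment, ← hφ.map_adj, adj_monomial, List.reverse_singleton]
  refine ⟨𝒦, i₁, i₂, i₃,
    ⟨dom, hdense, fun i => q (monomial [i]), S, hsymm, fun i => (moment φ [i]).re⟩, ?_⟩
  set X := BooleanFock.op (fun i => q (monomial [i])) S (fun i => (moment φ [i]).re) with hX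
  -- This splits the GNS vector of P into its vacuum part φ(P) and its centred part. In these
  -- coordinates, multiplication by x_i is the Boolean Fock operator.
  let W : NCPoly d → BooleanFock dom := fun P => WithLp.toLp 2 (φ P, q P)
  have hW : ∀ i P, X i (W P) = W (monomial [i] * P) := by
    intro i P
    rw [hX, BooleanFock.op_apply]
    have e1 : ⟪q (monomial [i]), q P⟫_ℂ + ((moment φ [i]).re : ℂ) * φ P = φ (monomial [i] * P) := by
      rw [hinner, ← hleft, hreal, hπ, centering_apply, _root_.mul_sub, mul_smul_comm,
        _root_.mul_one, map_sub, map_smul, adj_monomial, List.reverse_singleton, moment,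
        smul_eq_mul]
      ring
    have e2 : φ P • q (monomial [i]) + S i (q P) = q (monomial [i] * P) := by
      rw [hS, LinearMap.comp_apply, mulVar_apply, hπ, centering_apply, _root_.mul_sub,
        mul_smul_comm, _root_.mul_one, map_sub, map_smul]
      abel
    exact congrArg (WithLp.toLp 2) (Prod.ext e1 e2)
  have hw : ∀ u, word X u (BooleanFock.vacuum dom) = W (monomial u) := by
    intro u
    induction u with
    | nil =>
      rw [word_nil, Module.End.one_apply, monomial_nil]
      exact congrArg (WithLp.toLp 2) (Prod.ext hφ.map_one.symm hq1.symm)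
    | cons i u ih => rw [word_cons, Module.End.mul_apply, ih, hW, ← monomial_cons]
  refine .of_moment_eq (BooleanFock.denseRange_incl (by simpa [DenseRange] using hdense))
    (BooleanFock.op_isSymmetric hsymm _) BooleanFock.norm_vacuum (funext fun u => ?_)
  rw [matrixSeries, hw]
  simp [BooleanFock.vacuum, W, moment]

end TwoState
end

noncomputable section

namespace TwoState

open NCSeries

variable {d : ℕ}

/-! ### The cumulant functional of a freely infinitely divisible state -/

open Filter Topology

/-- The coefficient at u is a polynomial in the coefficients of m on shorter words. This strictness
lets `tendsto_moment_freePow` recurse on length. -/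
theorem NCSeries.tendsto_subst {ι : Type*} {l : Filter ι} {m : ι → NCSeries d} {m₀ : NCSeries d}
    (f : NCSeries d) (u : List (Fin d))
    (h : ∀ v : List (Fin d), v.length < u.length → Tendsto (fun t => m t v) l (𝓝 (m₀ v))) :
    Tendsto (fun t => subst (m t) f u) l (𝓝 (subst m₀ f u)) := by
  simp only [subst_eq _ f, Pi.add_apply, mul_cons_apply]
  refine tendsto_const_nhds.add (tendsto_finsetSum _ fun k _ => ?_)
  have hk := k.isLt
  refine (h _ (by simp)).mul (tendsto_subst _ _ fun v hv => h v ?_)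
  simp only [List.length_drop] at hv
  omega
termination_by u.length
decreasing_by
  have := k.isLt
  simp only [List.length_drop]; omega

theorem NCSeries.subst_one_left (f : NCSeries d) : subst one f = f :=
  subst_eq_of_recursion id (fun f => by rw [one_mul]; exact eq_add_cons f) f

theorem freeCumulants_freePow (ρ : Functional d) (t : ℝ) :
    freeCumulants (freePow ρ t) = (t : ℂ) • freeCumulants ρ :=
  freeCumulants_ofFreeCumulants (by simp [freeCumulants_nil])

theorem freePow_one (ρ : Functional d) (t : ℝ) : freePow ρ t 1 = 1 :=
  ofFreeCumulants_one (by simp [freeCumulants_nil])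

theorem moment_freePow (ρ : Functional d) (t : ℝ) :
    moment (freePow ρ t) =
      one + (t : ℂ) • subst (moment (freePow ρ t)) (freeCumulants ρ) := by
  have := moment_eq_subst_freeCumulants (freePow_one ρ t)
  rwa [freeCumulants_freePow, subst_smul] at this

/-- In m_t = 1 + t R(m_t z), the coefficients of R(m_t z) converge by recursion, and the factor t
removes them in the limit. -/
theorem tendsto_moment_freePow (ρ : Functional d) (u : List (Fin d)) :
    Tendsto (fun t : ℝ => moment (freePow ρ t) u) (𝓝[>] 0) (𝓝 (one u)) := by
  have h1 : Tendsto (fun t : ℝ => subst (moment (freePow ρ t)) (freeCumulants ρ) u) (𝓝[>] 0)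
      (𝓝 (subst one (freeCumulants ρ) u)) :=
    tendsto_subst _ _ fun v hv => tendsto_moment_freePow ρ v
  have h2 : Tendsto (fun t : ℝ => (t : ℂ)) (𝓝[>] 0) (𝓝 0) := by
    have := (Complex.continuous_ofReal.tendsto 0).mono_left (nhdsWithin_le_nhds (s := Set.Ioi 0))
    simpa using this
  have h3 := (tendsto_const_nhds (x := (one u : ℂ))).add (h2.mul h1)
  rw [MulZeroClass.zero_mul, add_zero] at h3
  refine h3.congr fun t => ?_
  conv_rhs => rw [moment_freePow]
  rfl
termination_by u.length

/-- The constant term of a polynomial. -/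
def constantTerm : Functional d := ofMoments one

theorem moment_constantTerm : moment (constantTerm (d := d)) = one :=
  funext fun u => moment_ofMoments _ u

theorem constantTerm_single (u : FreeMonoid (Fin d)) (c : ℂ) :
    constantTerm (MonoidAlgebra.single u c) = c * one u.toList := by
  rw [single_eq_smul_monomial, map_smul, smul_eq_mul, ← moment_constantTerm]
  rfl

theorem constantTerm_one : constantTerm (1 : NCPoly d) = 1 := by
  rw [← moment_nil, moment_constantTerm]; rfl

theorem constantTerm_mul (P Q : NCPoly d) :
    constantTerm (P * Q) = constantTerm P * constantTerm Q := by
  induction P using MonoidAlgebra.induction_linear with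
  | zero => simp
  | add P P' hP hP' => rw [_root_.add_mul, map_add, hP, hP', map_add, _root_.add_mul]
  | single u a =>
    induction Q using MonoidAlgebra.induction_linear with
    | zero => simp
    | add P P' hP hP' => rw [_root_.mul_add, map_add, hP, hP', map_add, _root_.mul_add]
    | single v b =>
      have h : (one (u.toList ++ v.toList) : ℂ) = one u.toList * one v.toList := by
        by_cases hu : u.toList = [] <;> simp [one, hu]
      rw [MonoidAlgebra.single_mul_single, constantTerm_single, constantTerm_single,
        constantTerm_single, FreeMonoid.toList_mul, h]
      ring

theorem constantTerm_adj (P : NCPoly d) : constantTerm (adj P) = conj (constantTerm P) := by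
  induction P using MonoidAlgebra.induction_linear with
  | zero => simp [adj_zero]
  | add P P' hP hP' => rw [adj_add, map_add, hP, hP', map_add, map_add]
  | single u a =>
    rw [adj_single, constantTerm_single, constantTerm_single, map_mul]
    congr 1
    simp [one, apply_ite]

theorem constantTerm_mulVar (i : Fin d) (P : NCPoly d) : constantTerm (mulVar i P) = 0 := by
  have h : constantTerm (monomial [i] : NCPoly d) = 0 := congrFun moment_constantTerm [i]
  rw [mulVar_apply, constantTerm_mul, h, MulZeroClass.zero_mul]

/-- The linear functional with `x_u ↦ R^ρ_u`. -/
def cumulantFunctional (ρ : Functional d) : Functional d := ofMoments (freeCumulants ρ)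

/-- The difference quotient of `t ↦ ρ^{⊞ t}` at `0`. -/
def cumulantQuotient (ρ : Functional d) (t : ℝ) : Functional d :=
  ofMoments (subst (moment (freePow ρ t)) (freeCumulants ρ))

/-- The quotient is defined as R(m_t z), so no division by t is involved; as t decreases to 0 it
tends to R. -/
theorem freePow_eq (ρ : Functional d) (t : ℝ) :
    freePow ρ t = constantTerm + (t : ℂ) • cumulantQuotient ρ t := by
  refine Functional.ext_moment ?_
  rw [moment_freePow]
  funext u
  have h1 : constantTerm (monomial u : NCPoly d) = one u := congrFun moment_constantTerm u
  have h2 : cumulantQuotient ρ t (monomial u) =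
      subst (moment (freePow ρ t)) (freeCumulants ρ) u := moment_ofMoments _ u
  rw [moment, LinearMap.add_apply, LinearMap.smul_apply, h1, h2]
  rfl

theorem tendsto_cumulantQuotient (ρ : Functional d) (P : NCPoly d) :
    Tendsto (fun t : ℝ => cumulantQuotient ρ t P) (𝓝[>] 0) (𝓝 (cumulantFunctional ρ P)) := by
  induction P using MonoidAlgebra.induction_linear with
  | zero => simp
  | add P P' hP hP' => simpa only [map_add] using hP.add hP'
  | single u a =>
    rw [single_eq_smul_monomial]
    simp only [map_smul]
    have h2 : ∀ t, cumulantQuotient ρ t (monomial u.toList) =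
      subst (moment (freePow ρ t)) (freeCumulants ρ) u.toList := fun t => moment_ofMoments _ _
    have h3 : cumulantFunctional ρ (monomial u.toList) = freeCumulants ρ u.toList :=
      moment_ofMoments _ _
    simp only [h2, h3]
    refine Tendsto.const_smul ?_ a
    have h := tendsto_subst (l := 𝓝[>] (0 : ℝ)) (m := fun t => moment (freePow ρ t)) (m₀ := one)
      (freeCumulants ρ) u.toList fun v _ => tendsto_moment_freePow ρ v
    rwa [subst_one_left] at h

theorem cumulantFunctional_adj {ρ : Functional d} (hρ : IsFreelyInfDivState ρ) (P : NCPoly d) :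
    cumulantFunctional ρ (adj P) = conj (cumulantFunctional ρ P) := by
  refine tendsto_nhds_unique (tendsto_cumulantQuotient ρ (adj P)) ?_
  refine ((Complex.continuous_conj.tendsto _).comp (tendsto_cumulantQuotient ρ P)).congr' ?_
  filter_upwards [self_mem_nhdsWithin] with t ht
  have ht0 : (t : ℂ) ≠ 0 := by exact_mod_cast (ne_of_gt ht)
  have h := (hρ.isState_freePow t (le_of_lt ht)).map_adj P
  rw [freePow_eq, LinearMap.add_apply, LinearMap.add_apply, constantTerm_adj, map_add,
    add_right_inj, LinearMap.smul_apply, LinearMap.smul_apply, smul_eq_mul, smul_eq_mul, map_mul,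
    Complex.conj_ofReal] at h
  exact (mul_left_cancel₀ ht0 h).symm

/-- If P has no constant term, neither has P^*P, so ρ^{⊞ t}(P^*P) is t times the quotient at P^*P.
Positivity passes to the quotient for t > 0 and then to the limit. -/
theorem cumulantFunctional_nonneg {ρ : Functional d} (hρ : IsFreelyInfDivState ρ) {P : NCPoly d}
    (hP : constantTerm P = 0) : 0 ≤ (cumulantFunctional ρ (adj P * P)).re := by
  refine ge_of_tendsto ((Complex.continuous_re.tendsto _).comp
    (tendsto_cumulantQuotient ρ (adj P * P))) ?_
  filter_upwards [self_mem_nhdsWithin] with t ht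
  have h := (hρ.isState_freePow t (le_of_lt ht)).nonneg P
  rw [freePow_eq, LinearMap.add_apply, constantTerm_mul, hP, MulZeroClass.mul_zero, zero_add,
    LinearMap.smul_apply, smul_eq_mul, Complex.re_ofReal_mul] at h
  exact nonneg_of_mul_nonneg_right h ht

/-- The GNS construction for the cumulant functional on polynomials without constant term: ζ_i is
the class of x_i, H_i is multiplication by x_i, and λ_i is the first cumulant. -/
theorem exists_freeData {ρ : Functional d} (hρ : IsFreelyInfDivState ρ) :
    ∃ (ℋ : Type) (_ : NormedAddCommGroup ℋ) (_ : InnerProductSpace ℂ ℋ)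
      (_ : CompleteSpace ℋ) (B : FockData d ℋ), B.FreeRepresents ρ := by
  set π : Module.End ℂ (NCPoly d) := centering constantTerm with hπ
  set L := cumulantFunctional ρ with hL
  have hεπ : ∀ P, constantTerm (π P) = 0 := fun P => by
    rw [hπ, centering_apply, map_sub, map_smul, constantTerm_one, smul_eq_mul, _root_.mul_one,
      sub_self]
  -- Multiplication by x_i kills constant terms, so H_i needs no projection after it and is
  -- symmetric.
  have hπx : ∀ i P, π (mulVar i P) = mulVar i P := fun i P => by
    rw [hπ, centering_apply, constantTerm_mulVar, zero_smul, sub_zero]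
  have hπx1 : ∀ i, π (monomial [i]) = monomial [i] := fun i => by
    have := hπx i 1
    rwa [mulVar_apply, _root_.mul_one] at this
  obtain ⟨ℋ, i₁, i₂, i₃, dom, q, S, hdense, hsymm, hS, hq⟩ := exists_hilbert_of_core
    (formCore L π (cumulantFunctional_adj hρ) fun P => cumulantFunctional_nonneg hρ (hεπ P))
    (fun i => mulVar i ∘ₗ π)
    (fun i P Q => by
      change L (adj (π (mulVar i (π P))) * π Q) = L (adj (π P) * π (mulVar i (π Q)))
      rw [hπx, hπx, adj_mulVar_mul])
  have hinner : ∀ P Q, ⟪q P, q Q⟫_ℂ = L (adj (π P) * π Q) := hq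
  have hmon : ∀ u, L (monomial u) = freeCumulants ρ u := fun u => moment_ofMoments _ _
  have hreal : ∀ i, ((freeCumulants ρ [i]).re : ℂ) = freeCumulants ρ [i] := fun i => by
    rw [← Complex.conj_eq_iff_re, ← hmon, hL, ← cumulantFunctional_adj hρ, adj_monomial,
      List.reverse_singleton]
  -- The series ⟨P, H_u ζ_j⟩ z_u z_j collects the cumulants L(P^* x_u x_j); its empty-word
  -- coefficient is 0 by convention.
  have hvec : ∀ u P, vectorCumulants (fun i => q (monomial [i])) S (q P) u =
      if u = [] then 0 else L (adj (π P) * monomial u) := by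
    intro u
    induction u with
    | nil => intro P; rw [vectorCumulants_nil]; simp
    | cons j u ih =>
      intro P
      rw [vectorCumulants, hS, ih, LinearMap.comp_apply, hπx, adj_mulVar_mul, hinner, hπx1,
        mulVar_apply, ← monomial_cons]
      by_cases hu : u = [] <;> simp [hu]
  refine ⟨ℋ, i₁, i₂, i₃,
    ⟨dom, hdense, fun i => q (monomial [i]), S, hsymm, fun i => (freeCumulants ρ [i]).re⟩, ?_⟩
  refine isRepresentedOn_fullFock (by simpa [DenseRange] using hdense) hsymm hρ.isState.map_one ?_
  funext u
  cases u with
  | nil => rw [freeCumulants_nil, fockCumulants_nil]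
  | cons i u =>
    change _ = vectorCumulants (fun i => q (monomial [i])) S (q (monomial [i])) u +
      ((freeCumulants ρ [i]).re : ℂ) * one u
    rw [hvec, hreal, hπx1, adj_monomial, List.reverse_singleton, ← monomial_cons, hmon]
    by_cases hu : u = [] <;> simp [hu, one]

/-! ### The models -/

/-- Rescaling the data realises every ρ^{⊞ t} on the same Fock space, hence as a state. -/
theorem isFreelyInfDivState_of_freeCumulants {E : Type u} [NormedAddCommGroup E]
    [InnerProductSpace ℂ E] {ζ : Fin d → E} {H : Fin d → Module.End ℂ E} {lam : Fin d → ℝ}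
    (hH : ∀ i, (H i).IsSymmetric) {ρ : Functional d} (h1 : ρ 1 = 1)
    (h : freeCumulants ρ = fockCumulants ζ H lam) : IsFreelyInfDivState ρ where
  isState := (isRepresentedOn_fullFock (J := LinearIsometry.id (R := ℂ) (E := E))
    Function.surjective_id.denseRange hH h1 h).isState
  isState_freePow t ht := (isRepresentedOn_fullFock (J := LinearIsometry.id (R := ℂ) (E := E))
    Function.surjective_id.denseRange hH (freePow_one ρ t)
    (ζ := fun i => (√t : ℂ) • ζ i) (lam := fun i => t * lam i)
    (by rw [freeCumulants_freePow, h, fockCumulants_scale _ _ _ ht])).isState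

theorem AlgFock.gauge_add {E : Type u} [NormedAddCommGroup E] [InnerProductSpace ℂ E]
    (H H' : Module.End ℂ E) :
    AlgFock.gauge (H + H') = AlgFock.gauge H + AlgFock.gauge H' := by
  ext x
  refine AlgFock.induction_create (p := fun x => AlgFock.gauge (H + H') x =
      (AlgFock.gauge H + AlgFock.gauge H') x) x
    (fun x y hx hy => by rw [map_add, map_add, hx, hy])
    (fun c x hx => by rw [map_smul, map_smul, hx]) ?_ (fun e x _ => ?_)
  · simp [AlgFock.gauge_vacuum]
  · rw [LinearMap.add_apply, AlgFock.gauge_create, AlgFock.gauge_create, AlgFock.gauge_create,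
      LinearMap.add_apply, AlgFock.create_add]

theorem _root_.Submodule.denseRange_subtypeₗᵢ {𝓗 : Type*} [NormedAddCommGroup 𝓗]
    [InnerProductSpace ℂ 𝓗] {dom : Submodule ℂ 𝓗} (h : Dense (dom : Set 𝓗)) :
    DenseRange dom.subtypeₗᵢ := by
  simpa [DenseRange] using h

section Models

variable {𝒦 : Type u} [NormedAddCommGroup 𝒦] [InnerProductSpace ℂ 𝒦]
  {ℋ : Type v} [NormedAddCommGroup ℋ] [InnerProductSpace ℂ ℋ]
  {A : VectorData d 𝒦} {B : FockData d ℋ} {ρ ψ φ : Functional d}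

theorem denseRange_tensorIncl (A : VectorData d 𝒦) (B : FockData d ℋ) :
    DenseRange (tensorIncl A B) :=
  HilbertTensor.denseRange_incl (Submodule.denseRange_subtypeₗᵢ A.dense)
    (Submodule.denseRange_subtypeₗᵢ B.dense)

theorem isSymmetric_tensorOp (A : VectorData d 𝒦) (B : FockData d ℋ) (i : Fin d) :
    LinearMap.IsSymmetric (𝕜 := ℂ) (E := A.dom ⊗[ℂ] B.dom) (tensorOp A B i) :=
  tensorOp_isSymmetric A.symm B.symm i

/-- The common source of (a) and of the models in (c) and (d): read as Boolean cumulants this series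
gives Φ[ρ, ψ], read as free cumulants it gives 𝔹[Φ[ρ, ψ]]. -/
theorem phiCumulants_eq_fockCumulants (hA : A.Represents ψ) (hB : B.FreeRepresents ρ) :
    phiCumulants ρ ψ = fockCumulants (tensorVec A B) (tensorOp A B) B.lam := by
  have h := fockCumulants_tensor (ξ := A.ξ) (ζ := B.ζ) (H := B.H) A.symm B.lam
  rw [← hA.moment_eq_matrixSeries,
    ← freeCumulants_eq_fockCumulants B.symm hB.moment_eq_matrixSeries,
    ← phiCumulants_eq_cons ρ hA.map_one] at h
  exact h.symm

theorem isRepresentedOn_Phi (hA : A.Represents ψ) (hB : B.FreeRepresents ρ) :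
    IsRepresentedOn (𝓗 := BooleanFock (HilbertTensor 𝒦 ℋ)) (Phi ρ ψ)
      (BooleanFock.incl (tensorIncl A B))
      (BooleanFock.op (tensorVec A B) (tensorOp A B) B.lam)
      (BooleanFock.vacuum (A.dom ⊗[ℂ] B.dom)) :=
  isRepresentedOn_booleanFock (denseRange_tensorIncl A B) (isSymmetric_tensorOp A B) (Phi_one ρ ψ)
    (by rw [booleanCumulants_Phi ρ hA.map_one, phiCumulants_eq_fockCumulants hA hB])

theorem FockData.BooleanRepresents.freeCumulants_eq (hB : B.BooleanRepresents φ) :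
    freeCumulants (BercoviciPata φ) = fockCumulants B.ζ B.H B.lam := by
  rw [freeCumulants_BercoviciPata]
  exact booleanCumulants_eq_fockCumulants B.symm hB.moment_eq_matrixSeries

theorem isRepresentedOn_BercoviciPata (hB : B.BooleanRepresents φ) :
    B.FreeRepresents (BercoviciPata φ) :=
  isRepresentedOn_fullFock (Submodule.denseRange_subtypeₗᵢ B.dense) B.symm (BercoviciPata_one φ)
    hB.freeCumulants_eq

theorem isRepresentedOn_BercoviciPata_Phi (hA : A.Represents ψ) (hB : B.FreeRepresents ρ) :
    IsRepresentedOn (BercoviciPata (Phi ρ ψ)) (FullFock.incl (tensorIncl A B))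
      (AlgFock.op (tensorVec A B) (tensorOp A B) B.lam)
      (AlgFock.vacuum (A.dom ⊗[ℂ] B.dom)) :=
  isRepresentedOn_fullFock (denseRange_tensorIncl A B) (isSymmetric_tensorOp A B)
    (BercoviciPata_one _)
    (by rw [freeCumulants_BercoviciPata, booleanCumulants_Phi ρ hA.map_one,
      phiCumulants_eq_fockCumulants hA hB])

/-- Regrouping: every term except P_Ω ⊗ K_i belongs to the Fock model of 𝔹[Φ[ρ, ψ]] tensored with I.
-/
theorem convOp_eq (A : VectorData d 𝒦) (B : FockData d ℋ) (i : Fin d) :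
    convOp A B i =
      TensorProduct.map (AlgFock.op (tensorVec A B) (tensorOp A B) B.lam i) LinearMap.id +
        TensorProduct.map (proj (AlgFock.vacuum (A.dom ⊗[ℂ] B.dom))) (A.K i) := by
  have h1 : TensorProduct.map (1 : Module.End ℂ (AlgFock (A.dom ⊗[ℂ] B.dom)))
      (LinearMap.id : A.dom →ₗ[ℂ] A.dom) = 1 := TensorProduct.map_id
  rw [convOp, leftK, AlgFock.op, tensorOp, AlgFock.gauge_add, TensorProduct.map_add_left,
    TensorProduct.map_add_left, TensorProduct.map_add_left, TensorProduct.map_add_left,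
    TensorProduct.map_smul_left, h1]
  abel

theorem isRepresentedOn_freeConv (hA : A.Represents ψ) (hB : B.FreeRepresents ρ) :
    IsRepresentedOn (freeConv ψ ρ) (convIncl A B) (convOp A B)
      (AlgFock.vacuum (A.dom ⊗[ℂ] B.dom) ⊗ₜ[ℂ] A.ξ) := by
  have hT := AlgFock.op_isSymmetric (ζ := tensorVec A B) (isSymmetric_tensorOp A B) B.lam
  refine .of_moment_eq (HilbertTensor.denseRange_incl
    (FullFock.denseRange_incl (denseRange_tensorIncl A B))
    (Submodule.denseRange_subtypeₗᵢ A.dense)) (fun i => ?_) ?_ ?_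
  · rw [convOp_eq]
    exact (tensorMap_isSymmetric (hT i) LinearMap.IsSymmetric.id).add
      (tensorMap_isSymmetric (proj_isSymmetric _) (A.symm i))
  · rw [TensorProduct.norm_tmul, AlgFock.norm_vacuum, A.norm_ξ, _root_.mul_one]
  -- Subordination and the operator computation both give m(B z) B.
  · rw [moment_freeConv ρ hA.map_one,
      (isRepresentedOn_BercoviciPata_Phi hA hB).moment_eq_matrixSeries,
      hA.moment_eq_matrixSeries, ← matrixSeries_tensor_vacuum hT A.symm]
    congr 1
    funext i
    exact (convOp_eq A B i).symm

end Models

end TwoState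
end

/-! ### The main theorem -/

open TwoState in
theorem mainTheorem9 (d : ℕ) :
    -- every state and every freely infinitely divisible state arises from data
    ((∀ ψ : Functional d, IsState ψ →
        ∃ (𝒦 : Type) (_ : NormedAddCommGroup 𝒦) (_ : InnerProductSpace ℂ 𝒦)
          (_ : CompleteSpace 𝒦) (A : VectorData d 𝒦), A.Represents ψ) ∧
      (∀ φ : Functional d, IsState φ →
        ∃ (𝒦 : Type) (_ : NormedAddCommGroup 𝒦) (_ : InnerProductSpace ℂ 𝒦)
          (_ : CompleteSpace 𝒦) (C : FockData d 𝒦), C.BooleanRepresents φ) ∧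
      (∀ ρ : Functional d, IsFreelyInfDivState ρ →
        ∃ (ℋ : Type) (_ : NormedAddCommGroup ℋ) (_ : InnerProductSpace ℂ ℋ)
          (_ : CompleteSpace ℋ) (B : FockData d ℋ), B.FreeRepresents ρ)) ∧
    -- (a) the model of `Φ[ρ, ψ]` on the Boolean Fock space over `𝒦 ⊗ ℋ`
    (∀ ρ ψ : Functional d, IsFreelyInfDivState ρ → IsState ψ →
      IsState (Phi ρ ψ) ∧
      ∀ (𝒦 : Type u) [NormedAddCommGroup 𝒦] [InnerProductSpace ℂ 𝒦] [CompleteSpace 𝒦]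
        (ℋ : Type v) [NormedAddCommGroup ℋ] [InnerProductSpace ℂ ℋ] [CompleteSpace ℋ]
        (A : VectorData d 𝒦) (B : FockData d ℋ), A.Represents ψ → B.FreeRepresents ρ →
        IsRepresentedOn (𝓗 := BooleanFock (HilbertTensor 𝒦 ℋ)) (Phi ρ ψ)
          (BooleanFock.incl (tensorIncl A B))
          (BooleanFock.op (tensorVec A B) (tensorOp A B) B.lam)
          (BooleanFock.vacuum (A.dom ⊗[ℂ] B.dom))) ∧
    -- (b) the model of `𝔹[φ]` on the full Fock space over `𝒦`
    (∀ φ : Functional d, IsState φ →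
      IsFreelyInfDivState (BercoviciPata φ) ∧
      ∀ (𝒦 : Type u) [NormedAddCommGroup 𝒦] [InnerProductSpace ℂ 𝒦] [CompleteSpace 𝒦]
        (C : FockData d 𝒦), C.BooleanRepresents φ → C.FreeRepresents (BercoviciPata φ)) ∧
    -- (c) the model of `ψ ⊞ ρ` on `𝓕(𝒦 ⊗ ℋ) ⊗ 𝒦`
    (∀ ρ ψ : Functional d, IsFreelyInfDivState ρ → IsState ψ →
      IsState (freeConv ψ ρ) ∧
      ∀ (𝒦 : Type u) [NormedAddCommGroup 𝒦] [InnerProductSpace ℂ 𝒦] [CompleteSpace 𝒦]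
        (ℋ : Type v) [NormedAddCommGroup ℋ] [InnerProductSpace ℂ ℋ] [CompleteSpace ℋ]
        (A : VectorData d 𝒦) (B : FockData d ℋ), A.Represents ψ → B.FreeRepresents ρ →
        IsRepresentedOn (freeConv ψ ρ) (convIncl A B) (convOp A B)
          (AlgFock.vacuum (A.dom ⊗[ℂ] B.dom) ⊗ₜ[ℂ] A.ξ)) ∧
    -- (d) `𝔹[Φ[ρ, ψ]] = Φ[ρ, ψ ⊞ ρ]`, with a common model on `𝓕(𝒦 ⊗ ℋ)`
    (∀ ρ ψ : Functional d, IsFreelyInfDivState ρ → IsState ψ →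
      BercoviciPata (Phi ρ ψ) = Phi ρ (freeConv ψ ρ) ∧
      ∀ (𝒦 : Type u) [NormedAddCommGroup 𝒦] [InnerProductSpace ℂ 𝒦] [CompleteSpace 𝒦]
        (ℋ : Type v) [NormedAddCommGroup ℋ] [InnerProductSpace ℂ ℋ] [CompleteSpace ℋ]
        (A : VectorData d 𝒦) (B : FockData d ℋ), A.Represents ψ → B.FreeRepresents ρ →
        IsRepresentedOn (BercoviciPata (Phi ρ ψ)) (FullFock.incl (tensorIncl A B))
          (AlgFock.op (tensorVec A B) (tensorOp A B) B.lam)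
          (AlgFock.vacuum (A.dom ⊗[ℂ] B.dom)) ∧
        IsRepresentedOn (Phi ρ (freeConv ψ ρ)) (FullFock.incl (tensorIncl A B))
          (AlgFock.op (tensorVec A B) (tensorOp A B) B.lam)
          (AlgFock.vacuum (A.dom ⊗[ℂ] B.dom))) := by
  refine ⟨⟨fun ψ hψ => exists_vectorData hψ, fun φ hφ => exists_booleanData hφ,
    fun ρ hρ => exists_freeData hρ⟩, fun ρ ψ hρ hψ => ⟨?_, ?_⟩, fun φ hφ => ⟨?_, ?_⟩,
    fun ρ ψ hρ hψ => ⟨?_, ?_⟩, fun ρ ψ hρ hψ => ⟨BercoviciPata_Phi ρ hψ.map_one, ?_⟩⟩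
  -- Positivity does not depend on the given data, so it is read off from the model over one choice
  -- of data.
  · obtain ⟨𝒦, _, _, _, A, hA⟩ := exists_vectorData hψ
    obtain ⟨ℋ, _, _, _, B, hB⟩ := exists_freeData hρ
    exact (isRepresentedOn_Phi hA hB).isState
  · intro 𝒦 _ _ _ ℋ _ _ _ A B hA hB
    exact isRepresentedOn_Phi hA hB
  · obtain ⟨𝒦, _, _, _, C, hC⟩ := exists_booleanData hφ
    exact isFreelyInfDivState_of_freeCumulants C.symm (BercoviciPata_one φ) hC.freeCumulants_eq
  · intro 𝒦 _ _ _ C hC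
    exact isRepresentedOn_BercoviciPata hC
  · obtain ⟨𝒦, _, _, _, A, hA⟩ := exists_vectorData hψ
    obtain ⟨ℋ, _, _, _, B, hB⟩ := exists_freeData hρ
    exact (isRepresentedOn_freeConv hA hB).isState
  · intro 𝒦 _ _ _ ℋ _ _ _ A B hA hB
    exact isRepresentedOn_freeConv hA hB
  · intro 𝒦 _ _ _ ℋ _ _ _ A B hA hB
    have h := isRepresentedOn_BercoviciPata_Phi hA hB
    exact ⟨h, BercoviciPata_Phi ρ hψ.map_one ▸ h⟩
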